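/- **Conventions.** A tangle is a diagram in a disc with four ends NW, NE, SW, SE. The tangle $1$ is a single crossing whose over-strand runs from SW to NE, $\overline{1}=-1$ is the single crossing whose over-strand runs from NW to SE, the tangle $0$ consists of two horizontal arcs and $\infty$ of two vertical arcs. The sum $s+t$ joins the ends NE, SE of $s$ to the ends NW, SW of $t$; the integral tangle $\pm n$ is the sum of $n$ copies of $\pm 1$; the product $st$ is obtained by reflecting the diagram $s$ in the line through NW and SE (over-strands stay over-strands) and then adding $t$. For integers $a_1,\dots,a_m$ the rational tangle $a_1a_2\dots a_m$ is $((\cdots(a_1a_2)a_3\cdots)a_m)$. A rational number $t>0$, $t\neq 1$, is written as $t=a_m+\cfrac{1}{a_{m-1}+\cfrac{1}{\ddots+\cfrac{1}{a_1}}}$ with integers $a_1\ge 2$, $a_k\ge 1$ for $1<k<m$ and (if $m>1$) $a_m\ge 0$, and it is identified with the tangle $a_1a_2\dots a_m$; $-t$ is identified with the tangle $(-a_1)(-a_2)\dots(-a_m)$. The link $1*t$ is obtained from a tangle $t$ by joining NW to NE and SW to SE without further crossings. For $p\ge 0$, $e\in\mathbb{Z}$ and rational numbers $t_1,\dots,t_p\notin\{0,1,-1\}$,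 the Montesinos link is $M(e;t_1,\dots,t_p)=1*(e+t_10+\dots+t_p0)$. Put $$\varepsilon=e+\sum_{i=1}^p\left\lfloor\frac1{t_i}\right\rfloor .$$ Links are unoriented and are considered up to isotopy. A diagram is *alternating* if over- and undercrossings alternate along each of its components. It is *adequate* if, in its all-$A$ state and in its all-$B$ state, the two arcs that replace any crossing always belong to two different state circles. **Proposition.** Let $L=M(e;t_1,\dots,t_p)$ be a Montesinos link. 1. If $\left|\varepsilon+\frac p2\right|>\frac p2-1$, then $L$ has an alternating diagram. 2. If $\left|\varepsilon+\frac p2\right|<\frac p2-1$ and none of the numbers $1/t_1,\dots,1/t_p$ is an integer, then $L$ has a diagram that is adequate and not alternating. -/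

import Mathlib

/-!  Unoriented links are handled through their planar diagrams, up to planar isotopy and the
Reidemeister moves.  A diagram in general position with respect to the horizontal coordinate is
read from left to right and is recorded as the list of its elementary pieces. -/

namespace Montesinos

/-- The elementary pieces of a diagram, read from left to right.
* `birth`: a left-most point of the diagram (an arc `⊂`), which creates two adjacent strands;
* `death`: a right-most point of the diagram (an arc `⊃`), which joins two adjacent strands;
* `cross s`: a crossing of two adjacent strands.  For `s = true` the over-strand has positive
  slope (it runs from SW to NE), for `s = false` it has negative slope (from NW to SE). -/
inductive Gen
  | birth
  | death
  | cross (s : Bool)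
  deriving DecidableEq

/-- The number of strands that enter a piece from the left. -/
def Gen.ins : Gen → ℕ
  | birth => 0
  | death => 2
  | cross _ => 2

/-- The number of strands that leave a piece to the right. -/
def Gen.outs : Gen → ℕ
  | birth => 2
  | death => 0
  | cross _ => 2

/-- A layer of a diagram: one elementary piece with `pos` horizontal strands above it (and any
number of horizontal strands below it).  Strands are numbered `0, 1, 2, …` from the top. -/
structure Layer where
  gen : Gen
  pos : ℕ
  deriving DecidableEq

/-- The layer `l` leads from `n` strands on its left to `m` strands on its right. -/
def Layer.Leads (l : Layer) (n m : ℕ) : Prop :=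
  ∃ d, n = l.pos + l.gen.ins + d ∧ m = l.pos + l.gen.outs + d

/-- A diagram, as the list of its layers from left to right. -/
abbrev Word := List Layer

/-- `w` is the diagram of a tangle with `n` ends on the left and `m` ends on the right. -/
def IsTangle : ℕ → Word → ℕ → Prop
  | n, [], m => n = m
  | n, l :: w, m => ∃ j, l.Leads n j ∧ IsTangle j w m

/-- Move a diagram down by `k` strands. -/
def shift (k : ℕ) (w : Word) : Word := w.map fun l => ⟨l.gen, k + l.pos⟩

/-- A link diagram: a diagram without ends. -/
structure LinkDiagram where
  word : Word
  closed : IsTangle 0 word 0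

/-! ### Isotopy of links -/

/-- The local moves on diagrams.  The first group generates planar isotopy (together with the
horizontal stretching that is built into words); the second group are the Reidemeister moves. -/
inductive Move : Word → Word → Prop
  /-- pieces on disjoint sets of strands may be moved horizontally past each other -/
  | far (g h : Gen) (k d : ℕ) :
      Move [⟨g, k⟩, ⟨h, k + g.outs + d⟩] [⟨h, k + g.ins + d⟩, ⟨g, k⟩]
  /-- a zigzag may be straightened -/
  | zigzag (k : ℕ) : Move [⟨.birth, k + 1⟩, ⟨.death, k⟩] []
  | zagzig (k : ℕ) : Move [⟨.birth, k⟩, ⟨.death, k + 1⟩] []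
  /-- a crossing may be moved from one leg of a turning arc to the other one -/
  | slideBirth (s : Bool) (k : ℕ) :
      Move [⟨.birth, k + 1⟩, ⟨.cross s, k⟩] [⟨.birth, k⟩, ⟨.cross (!s), k + 1⟩]
  | slideDeath (s : Bool) (k : ℕ) :
      Move [⟨.cross s, k⟩, ⟨.death, k + 1⟩] [⟨.cross (!s), k + 1⟩, ⟨.death, k⟩]
  /-- first Reidemeister move -/
  | r1Birth (s : Bool) (k : ℕ) : Move [⟨.birth, k⟩, ⟨.cross s, k⟩] [⟨.birth, k⟩]
  | r1Death (s : Bool) (k : ℕ) : Move [⟨.cross s, k⟩, ⟨.death, k⟩] [⟨.death, k⟩]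
  /-- second Reidemeister move -/
  | r2 (s : Bool) (k : ℕ) : Move [⟨.cross s, k⟩, ⟨.cross (!s), k⟩] []
  /-- third Reidemeister move -/
  | r3 (s : Bool) (k : ℕ) :
      Move [⟨.cross s, k⟩, ⟨.cross s, k + 1⟩, ⟨.cross s, k⟩]
        [⟨.cross s, k + 1⟩, ⟨.cross s, k⟩, ⟨.cross s, k + 1⟩]

/-- `D'` arises from `D` by one local move. -/
def LinkDiagram.Step (D D' : LinkDiagram) : Prop :=
  ∃ x y u v : Word, Move u v ∧ D.word = x ++ u ++ y ∧ D'.word = x ++ v ++ y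

/-- `D` and `D'` are diagrams of the same (unoriented) link, up to isotopy. -/
def LinkDiagram.Isotopic : LinkDiagram → LinkDiagram → Prop :=
  Relation.EqvGen LinkDiagram.Step

/-! ### Alternating and adequate diagrams

The point `(i, j)` is the point of the `j`-th strand on the vertical line between the first `i`
layers and the remaining ones. -/

/-- The strand `j` on the left of the layer `l` passes horizontally by the piece in `l` and is
the strand `j'` on its right. -/
def Layer.Passes (l : Layer) (j j' : ℕ) : Prop :=
  (j < l.pos ∧ j' = j) ∨ ∃ d, j = l.pos + l.gen.ins + d ∧ j' = l.pos + l.gen.outs + d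

/-- Two points are neighbours on an arc of the diagram that has no crossing between them. -/
inductive ArcAdj (w : Word) : ℕ × ℕ → ℕ × ℕ → Prop
  | pass (i : ℕ) (l : Layer) (j j' : ℕ) (hl : w[i]? = some l) (h : l.Passes j j') :
      ArcAdj w (i, j) (i + 1, j')
  | birth (i k : ℕ) (hl : w[i]? = some ⟨.birth, k⟩) : ArcAdj w (i + 1, k) (i + 1, k + 1)
  | death (i k : ℕ) (hl : w[i]? = some ⟨.death, k⟩) : ArcAdj w (i, k) (i, k + 1)

/-- The four ends of a crossing. -/
inductive Corner
  | nw
  | ne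
  | sw
  | se
  deriving DecidableEq

/-- The point at which an end of the crossing `⟨cross s, k⟩` in the layer number `i` lies. -/
def Corner.point (i k : ℕ) : Corner → ℕ × ℕ
  | nw => (i, k)
  | sw => (i, k + 1)
  | ne => (i + 1, k)
  | se => (i + 1, k + 1)

/-- An end of the crossing `cross s` belongs to its over-strand. -/
def Corner.IsOver (s : Bool) : Corner → Prop
  | nw => s = false
  | se => s = false
  | sw => s = true
  | ne => s = true

/-- A diagram is alternating if over- and undercrossings alternate along its components: of the
two ends of any edge (arc from one crossing to the next), exactly one is an end of an
over-strand. -/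
def LinkDiagram.Alternating (D : LinkDiagram) : Prop :=
  ∀ (i k : ℕ) (s : Bool) (c : Corner) (i' k' : ℕ) (s' : Bool) (c' : Corner),
    D.word[i]? = some ⟨.cross s, k⟩ → D.word[i']? = some ⟨.cross s', k'⟩ →
    (i, c) ≠ (i', c') →
    Relation.EqvGen (ArcAdj D.word) (c.point i k) (c'.point i' k') →
    (c.IsOver s ↔ ¬ c'.IsOver s')

/-- Neighbouring points in the diagram that results if all crossings are smoothed in the same
way: by the `A`-smoothing (`σ = true`) or by the `B`-smoothing (`σ = false`).
The `A`-smoothing joins the two regions that the over-strand sweeps out when it is turned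
counterclockwise; for `cross true` these are the regions above and below the crossing, so it
replaces the crossing by two vertical arcs `⊃ ⊂`, and for `cross false` by two horizontal
strands. -/
inductive StateAdj (w : Word) (σ : Bool) : ℕ × ℕ → ℕ × ℕ → Prop
  | arc (x y : ℕ × ℕ) (h : ArcAdj w x y) : StateAdj w σ x y
  | left (i k : ℕ) (hl : w[i]? = some ⟨.cross σ, k⟩) : StateAdj w σ (i, k) (i, k + 1)
  | right (i k : ℕ) (hl : w[i]? = some ⟨.cross σ, k⟩) :
      StateAdj w σ (i + 1, k) (i + 1, k + 1)
  | top (i k : ℕ) (hl : w[i]? = some ⟨.cross (!σ), k⟩) : StateAdj w σ (i, k) (i + 1, k)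
  | bottom (i k : ℕ) (hl : w[i]? = some ⟨.cross (!σ), k⟩) :
      StateAdj w σ (i, k + 1) (i + 1, k + 1)

/-- A diagram is adequate if, in the all-`A` state as well as in the all-`B` state, the two arcs
that replace any crossing belong to two different state circles.  (For both smoothings, one of
these arcs contains the NW end of the crossing and the other one its SE end.) -/
def LinkDiagram.Adequate (D : LinkDiagram) : Prop :=
  ∀ (σ : Bool) (i k : ℕ) (s : Bool), D.word[i]? = some ⟨.cross s, k⟩ →
    ¬ Relation.EqvGen (StateAdj D.word σ) (i, k) (i + 1, k + 1)

/-! ### Tangles in Conway's notation -/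

/-- Tangles with ends NW, NE, SW, SE that are built from the elementary tangles `0`, `∞`, `1`,
`-1` by placing two tangles beside each other (`add`, Conway's sum) or on top of each other
(`stack`). -/
inductive Tangle
  | zero
  | infty
  | one
  | negOne
  | add (s t : Tangle)
  | stack (s t : Tangle)

/-- Reflection of the tangle diagram in the line through NW and SE (over-strands stay
over-strands): it keeps the ends NW and SE, exchanges NE and SW, and turns the left-to-right
order into the top-to-bottom order. -/
def Tangle.reflect : Tangle → Tangle
  | zero => infty
  | infty => zero
  | one => one
  | negOne => negOne
  | add s t => stack s.reflect t.reflect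
  | stack s t => add s.reflect t.reflect

/-- The tangle product `s t`: reflect `s`, then add `t`. -/
def Tangle.mul (s t : Tangle) : Tangle := add s.reflect t

/-- The sum of `n` copies of a tangle. -/
def Tangle.copies (s : Tangle) : ℕ → Tangle
  | 0 => zero
  | n + 1 => add (s.copies n) s

/-- The integral tangles `n = 1 + ⋯ + 1` and `-n = (-1) + ⋯ + (-1)`. -/
def Tangle.int : ℤ → Tangle
  | .ofNat n => one.copies n
  | .negSucc n => negOne.copies (n + 1)

/-- The rational tangle `a₁ a₂ … aₘ = ((⋯ (a₁ a₂) a₃ ⋯) aₘ)`. -/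
def Tangle.ofInts : List ℤ → Tangle
  | [] => zero
  | a :: l => l.foldl (fun s b => s.mul (int b)) (int a)

/-- The word of a tangle; the ends NW, SW are the strands `0`, `1` on the left, the ends NE, SE
are the strands `0`, `1` on the right. -/
def Tangle.word : Tangle → Word
  | zero => []
  | infty => [⟨.death, 0⟩, ⟨.birth, 0⟩]
  | one => [⟨.cross true, 0⟩]
  | negOne => [⟨.cross false, 0⟩]
  | add s t => s.word ++ t.word
  | stack s t => [⟨.birth, 1⟩] ++ s.word ++ shift 2 t.word ++ [⟨.death, 1⟩]

theorem IsTangle.append {n m k : ℕ} {u v : Word} (hu : IsTangle n u m) (hv : IsTangle m v k) :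
    IsTangle n (u ++ v) k := by
  induction u generalizing n with
  | nil => cases hu; exact hv
  | cons l u ih =>
    obtain ⟨j, h, h'⟩ := hu
    exact ⟨j, h, ih h'⟩

/-- A tangle diagram with `a` more strands above it and `b` more strands below it. -/
theorem IsTangle.shift {n m : ℕ} {u : Word} (hu : IsTangle n u m) (a b : ℕ) :
    IsTangle (a + n + b) (shift a u) (a + m + b) := by
  induction u generalizing n with
  | nil => cases hu; rfl
  | cons l u ih =>
    obtain ⟨j, ⟨d, h1, h2⟩, h'⟩ := hu
    refine ⟨a + j + b, ⟨d + b, ?_, ?_⟩, ih h'⟩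
    · simp only []; omega
    · simp only []; omega

theorem shift_zero (u : Word) : shift 0 u = u := by
  simp [shift]

theorem Tangle.isTangle_word (t : Tangle) : IsTangle 2 t.word 2 := by
  induction t with
  | zero => rfl
  | infty => exact ⟨0, ⟨0, rfl, rfl⟩, 2, ⟨0, rfl, rfl⟩, rfl⟩
  | one => exact ⟨2, ⟨0, rfl, rfl⟩, rfl⟩
  | negOne => exact ⟨2, ⟨0, rfl, rfl⟩, rfl⟩
  | add s t hs ht => exact hs.append ht
  | stack s t hs ht =>
    have h1 : IsTangle 4 s.word 4 := by simpa [shift_zero] using hs.shift 0 2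
    have h2 : IsTangle 4 (shift 2 t.word) 4 := ht.shift 2 0
    have h0 : IsTangle 2 [⟨.birth, 1⟩] 4 := ⟨4, ⟨1, rfl, rfl⟩, rfl⟩
    have h3 : IsTangle 4 [⟨.death, 1⟩] 2 := ⟨2, ⟨1, rfl, rfl⟩, rfl⟩
    exact ((h0.append h1).append h2).append h3

/-- The vertical closure `1*t`: NW is joined to NE by an arc above the tangle, and SW to SE by an
arc below it. -/
def Tangle.closure (t : Tangle) : LinkDiagram where
  word := [⟨.birth, 0⟩, ⟨.birth, 2⟩] ++ shift 1 t.word ++ [⟨.death, 0⟩, ⟨.death, 0⟩]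
  closed := by
    have h0 : IsTangle 0 [⟨.birth, 0⟩, ⟨.birth, 2⟩] 4 := ⟨2, ⟨0, rfl, rfl⟩, 4, ⟨0, rfl, rfl⟩, rfl⟩
    have h1 : IsTangle 4 (shift 1 t.word) 4 := t.isTangle_word.shift 1 1
    have h2 : IsTangle 4 [⟨.death, 0⟩, ⟨.death, 0⟩] 0 := ⟨2, ⟨2, rfl, rfl⟩, 0, ⟨0, rfl, rfl⟩, rfl⟩
    exact (h0.append h1).append h2

/-! ### Rational tangles and Montesinos links -/

/-- The numbers `a₁, …, aₘ` with `α / β = [aₘ, …, a₁]`, computed by the Euclidean algorithm. -/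
def euclid (α β : ℕ) : List ℕ :=
  if _ : β = 0 then [] else euclid β (α % β) ++ [α / β]
termination_by β
decreasing_by exact Nat.mod_lt _ (Nat.pos_of_ne_zero ‹_›)

/-- The integers `a₁, …, aₘ` of the rational tangle `a₁ … aₘ` that corresponds to `t`; they all
have the sign of `t`, and `t = [aₘ, …, a₁]`. -/
def conwayInts (t : ℚ) : List ℤ :=
  (euclid t.num.natAbs t.den).map fun a : ℕ => t.num.sign * (a : ℤ)

/-- The continued fraction `[aₘ, …, a₁] = aₘ + 1 / (aₘ₋₁ + 1 / (⋯ + 1 / a₁))`, for the list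
`a₁, …, aₘ`. -/
def fraction : List ℤ → ℚ
  | [] => 0
  | a :: l => l.foldl (fun x b => b + 1 / x) a

theorem fraction_append {l : List ℤ} (hl : l ≠ []) (b : ℤ) :
    fraction (l ++ [b]) = b + 1 / fraction l := by
  cases l with
  | nil => exact absurd rfl hl
  | cons a l => simp [fraction, List.foldl_append]

theorem euclid_spec (β α : ℕ) (hc : α.Coprime β) (h0 : α ≠ 0) (hβ : β ≠ 0)
    (h1 : ¬ (α = 1 ∧ β = 1)) :
    euclid α β ≠ [] ∧ (∀ x ∈ (euclid α β).head?, 2 ≤ x) ∧ (∀ x ∈ (euclid α β).dropLast, 1 ≤ x) ∧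
      fraction ((euclid α β).map fun a : ℕ => (a : ℤ)) = (α : ℚ) / β := by
  induction β using Nat.strong_induction_on generalizing α with
  | _ β ih =>
  rw [euclid, dif_neg hβ]
  by_cases hb : β = 1
  · subst hb
    have : 2 ≤ α := by omega
    simp [euclid, fraction, this, Nat.mod_one]
  · have hr : α % β ≠ 0 := fun h => by
      have := Nat.Coprime.eq_one_of_dvd hc.symm (Nat.dvd_of_mod_eq_zero h)
      exact hb this
    have hlt : α % β < β := Nat.mod_lt _ (Nat.pos_of_ne_zero hβ)
    have hc' : β.Coprime (α % β) := by
      have h := hc.symm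
      rw [Nat.Coprime, Nat.gcd_rec] at h
      exact Nat.Coprime.symm h
    obtain ⟨i1, i2, i3, i4⟩ := ih (α % β) hlt β hc' hβ hr (fun h => hb h.1)
    refine ⟨by simp, ?_, ?_, ?_⟩
    · rw [List.head?_append_of_ne_nil _ i1]; exact i2
    · rw [List.dropLast_concat]
      intro x hx
      rw [← List.dropLast_append_getLast i1] at hx
      rcases List.mem_append.1 hx with h | h
      · exact i3 x h
      · rw [List.mem_singleton.1 h]
        by_contra hcon
        have hz : (euclid β (α % β)).getLast i1 = β / (α % β) := by
          have : ∀ l : List ℕ, ∀ hl : l ≠ [],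
              l = euclid (α % β) (β % (α % β)) ++ [β / (α % β)] →
              l.getLast hl = β / (α % β) := by
            intro l hl e; subst e; simp
          exact this _ i1 (by conv_lhs => rw [euclid, dif_neg hr])
        rw [hz] at hcon
        exact hcon (Nat.div_pos hlt.le (Nat.pos_of_ne_zero hr))
    · rw [List.map_append, List.map_cons, List.map_nil, fraction_append (by simpa using i1), i4]
      have e := Nat.div_add_mod α β
      have e' : (α : ℚ) = β * (α / β : ℕ) + (α % β : ℕ) := by exact_mod_cast e.symm
      have hβ' : (β : ℚ) ≠ 0 := by exact_mod_cast hβ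
      rw [one_div_div, eq_div_iff hβ', add_mul, div_mul_cancel₀ _ hβ']
      have e2 : (((α / β : ℕ) : ℤ) : ℚ) = ((α / β : ℕ) : ℚ) := Int.cast_natCast _
      rw [e2]
      linarith [mul_comm (β : ℚ) ((α / β : ℕ) : ℚ)]

/-- For `t > 0`, `t ≠ 1`, the list `conwayInts t` is a list `a₁, …, aₘ` with `a₁ ≥ 2`, `aₖ ≥ 1`
for `1 < k < m`, `aₘ ≥ 0`, and `t = [aₘ, …, a₁]`. -/
theorem conwayInts_spec (t : ℚ) (h0 : 0 < t) (h1 : t ≠ 1) :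
    conwayInts t ≠ [] ∧ (∀ x ∈ (conwayInts t).head?, 2 ≤ x) ∧
      (∀ x ∈ (conwayInts t).dropLast, 1 ≤ x) ∧ (∀ x ∈ conwayInts t, 0 ≤ x) ∧
      fraction (conwayInts t) = t := by
  have hn : 0 < t.num := Rat.num_pos.2 h0
  have hne : ¬ (t.num.natAbs = 1 ∧ t.den = 1) := by
    rintro ⟨h, h'⟩
    apply h1
    have : t.num = 1 := by omega
    rw [← Rat.num_div_den t, this, h']; norm_num
  obtain ⟨i1, i2, i3, i4⟩ := euclid_spec t.den t.num.natAbs t.reduced (by omega) t.den_nz hne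
  have he : conwayInts t = (euclid t.num.natAbs t.den).map fun a : ℕ => (a : ℤ) := by
    simp [conwayInts, Int.sign_eq_one_of_pos hn]
  rw [he]
  refine ⟨by simpa using i1, ?_, ?_, ?_, ?_⟩
  · intro x hx
    rw [List.head?_map] at hx
    obtain ⟨y, hy, rfl⟩ := Option.mem_map.1 hx
    exact_mod_cast i2 y hy
  · intro x hx
    rw [← List.map_dropLast] at hx
    obtain ⟨y, hy, rfl⟩ := List.mem_map.1 hx
    exact_mod_cast i3 y hy
  · intro x hx
    obtain ⟨y, hy, rfl⟩ := List.mem_map.1 hx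
    positivity
  · rw [i4]
    have h : ((t.num.natAbs : ℕ) : ℤ) = t.num := by omega
    have : ((t.num.natAbs : ℕ) : ℚ) = (t.num : ℚ) := by
      rw [← Int.cast_natCast, h]
    rw [this, Rat.num_div_den]

/-- For negative `t`, all signs are changed. -/
theorem conwayInts_neg (t : ℚ) : conwayInts (-t) = (conwayInts t).map fun a => -a := by
  simp [conwayInts, List.map_map, Function.comp_def]

/-- The rational tangle that corresponds to the rational number `t`. -/
def Tangle.rational (t : ℚ) : Tangle := ofInts (conwayInts t)

/-- The tangle `e + t₁0 + ⋯ + tₚ0`. -/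
def montesinosTangle {p : ℕ} (e : ℤ) (t : Fin p → ℚ) : Tangle :=
  (List.ofFn t).foldl (fun s x => s.add ((Tangle.rational x).mul .zero)) (.int e)

/-- The Montesinos link `M(e; t₁, …, tₚ) = 1*(e + t₁0 + ⋯ + tₚ0)`, given by its standard
diagram. -/
def montesinosLink {p : ℕ} (e : ℤ) (t : Fin p → ℚ) : LinkDiagram :=
  (montesinosTangle e t).closure

/-- `ε = e + ⌊1 / t₁⌋ + ⋯ + ⌊1 / tₚ⌋`. -/
def epsilon {p : ℕ} (e : ℤ) (t : Fin p → ℚ) : ℤ := e + ∑ i, ⌊1 / t i⌋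

end Montesinos

/-!
The argument has two halves: an isotopy that brings a Montesinos link into a normal form, and the
inspection of the diagrams of that form.

**Isotopy.** A tangle with its four ends moved to the right is an element of `TangleClass 0 4`, on
which the four-strand braid group acts by `twist`; `bend` turns it back into a tangle with two ends
on each side.  The rational tangles are the orbit of `∞`.  The order NE, SE, SW, NW of the ends is
chosen such that a crossing of the first two ends is a crossing added on the right, one of the
middle two ends is a crossing added below, and one of the last two ends is a crossing added on the
left (`bend_twist_zero`, `stack_bend_oneCrossing`, `bend_twist_two`).  The flype, by which
crossings pass through a rational tangle, then says that the first and the third generator of the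
braid group act in the same way on the orbit of `∞` (`twist_zero_eq_twist_two`).  This holds
because the kernel of the homomorphism from the four-strand to the three-strand braid group is
normal and fixes `∞` (`smul_eq_smul_of_braid`).

The expansion of `t` as a continued fraction writes the tangle `t0` as a rational block, with a
fraction of absolute value less than one, and a number of crossings (`cls_rational_mul_zero`).
Conjugation by the half twist of the three-strand braid group exchanges its generators; this
identifies a block of fraction `-r` followed by a crossing `1` with a block of fraction `1 - r`
(`IsRationalBlock.mul_oneCrossing`).  Together with the flype this leaves `ε` crossings and
positive blocks of fractions `1 / tᵢ - ⌊1 / tᵢ⌋` (`cls_montesinosTangle`).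

**Diagrams.** If `ε ≥ 0`, all crossings of this diagram have the same type with respect to a
checkerboard colouring of the plane, and if `ε ≤ -p`, this becomes true after the sign of every
block has been changed at the cost of a crossing.  Such a diagram is alternating: orient the strands
according to the parity of their height, then every edge runs from an overcrossing to an
undercrossing, or every edge runs the other way
(`LinkDiagram.alternating_of_checkered`).  If `2 - p ≤ ε ≤ -2`, the change of sign of the first
`-ε` blocks uses up all crossings, and at least two negative and at least two positive blocks
remain.  Each smoothing cuts the blocks of one sign from top to bottom and lets the blocks of the
other sign pass, so that a labelling of the state circles that separates the two arcs at each
crossing can be found block by block (`LinkDiagram.adequate_of_labelled`,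
`labelled_blocksWord_vertical`, `labelled_blocksWord_horizontal`).  The edge from a negative block
to the positive block next to it shows that this diagram is not alternating (`not_alternating`).
-/

namespace Montesinos

/-! ### Tangle diagrams up to isotopy -/

/-- The number of strands to the right of the word `w`, if `n` strands enter it from the left and
every layer finds the strands that it needs. -/
def run : ℕ → Word → Option ℕ
  | n, [] => some n
  | n, l :: w => if l.pos + l.gen.ins ≤ n then run (n - l.gen.ins + l.gen.outs) w else none

theorem isTangle_of_run {n m : ℕ} {w : Word} (h : run n w = some m) : IsTangle n w m := by
  induction w generalizing n with
  | nil => exact Option.some.inj h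
  | cons l w ih =>
    rw [run] at h
    split_ifs at h with hl
    exact ⟨_, ⟨n - (l.pos + l.gen.ins), by omega, by omega⟩, ih h⟩

theorem Move.shift {u v : Word} (h : Move u v) (a : ℕ) :
    Move (Montesinos.shift a u) (Montesinos.shift a v) := by
  cases h with
  | far g h k d => simpa [Montesinos.shift, add_assoc] using Move.far g h (a + k) d
  | zigzag k => exact Move.zigzag (a + k)
  | zagzig k => exact Move.zagzig (a + k)
  | slideBirth s k => exact Move.slideBirth s (a + k)
  | slideDeath s k => exact Move.slideDeath s (a + k)
  | r1Birth s k => exact Move.r1Birth s (a + k)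
  | r1Death s k => exact Move.r1Death s (a + k)
  | r2 s k => exact Move.r2 s (a + k)
  | r3 s k => exact Move.r3 s (a + k)

theorem shift_append (a : ℕ) (u v : Word) : shift a (u ++ v) = shift a u ++ shift a v := by
  simp [shift]

/-- Diagrams of tangles with `n` ends on the left and `m` ends on the right. -/
def Diagram (n m : ℕ) : Type := {w : Word // IsTangle n w m}

/-- Two diagrams differ by one local move. -/
def Diagram.Step {n m : ℕ} (u v : Diagram n m) : Prop :=
  ∃ x y a b : Word, Move a b ∧ u.1 = x ++ a ++ y ∧ v.1 = x ++ b ++ y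

/-- Tangles with `n` ends on the left and `m` ends on the right, up to isotopy.  All intermediate
diagrams of an isotopy have the same ends, which matters since a birth or a death makes sense
only at a height that exists. -/
def TangleClass (n m : ℕ) : Type := Quot (@Diagram.Step n m)

namespace TangleClass

/-- The isotopy class of a diagram. -/
def mk {n m : ℕ} (w : Word) (h : IsTangle n w m) : TangleClass n m := Quot.mk _ ⟨w, h⟩

theorem ind {n m : ℕ} {P : TangleClass n m → Prop} (h : ∀ w hw, P (mk w hw)) (x : TangleClass n m) :
    P x := by
  obtain ⟨w, hw⟩ := x
  exact h w hw

/-- Placing two tangles beside each other. -/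
def comp {n m k : ℕ} (x : TangleClass n m) (y : TangleClass m k) : TangleClass n k :=
  Quot.map₂ (fun u v => ⟨u.1 ++ v.1, u.2.append v.2⟩)
    (by
      rintro u v v' ⟨x, y, a, b, h, h1, h2⟩
      exact ⟨u.1 ++ x, y, a, b, h, by simp [h1], by simp [h2]⟩)
    (by
      rintro u u' v ⟨x, y, a, b, h, h1, h2⟩
      exact ⟨x, y ++ v.1, a, b, h, by simp [h1], by simp [h2]⟩) x y

theorem mk_comp_mk {n m k : ℕ} {u v : Word} (hu : IsTangle n u m) (hv : IsTangle m v k) :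
    (mk u hu).comp (mk v hv) = mk (u ++ v) (hu.append hv) := rfl

theorem comp_assoc {n m k l : ℕ} (x : TangleClass n m) (y : TangleClass m k)
    (z : TangleClass k l) : (x.comp y).comp z = x.comp (y.comp z) := by
  induction x using ind
  induction y using ind
  induction z using ind
  simp only [mk_comp_mk, List.append_assoc]

theorem comp_nil {n m : ℕ} (x : TangleClass n m) : x.comp (mk [] rfl) = x := by
  induction x using ind with
  | h w hw =>
    change mk (w ++ []) _ = _
    congr 1
    simp

instance (n : ℕ) : Monoid (TangleClass n n) where
  mul := comp
  one := mk [] rfl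
  mul_assoc := comp_assoc
  one_mul x := by
    induction x using ind
    rfl
  mul_one := comp_nil

end TangleClass

open TangleClass

/-- The words `u` and `v` are diagrams of isotopic tangles with `n` ends on the left and `m` ends
on the right. -/
def Isot (n m : ℕ) (u v : Word) : Prop :=
  ∃ (hu : IsTangle n u m) (hv : IsTangle n v m), mk u hu = mk v hv

namespace Isot

variable {n m k l : ℕ} {u v w x y : Word}

theorem refl (h : IsTangle n u m) : Isot n m u u := ⟨h, h, rfl⟩

theorem symm (h : Isot n m u v) : Isot n m v u :=
  let ⟨hu, hv, e⟩ := h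
  ⟨hv, hu, e.symm⟩

theorem trans (h : Isot n m u v) (h' : Isot n m v w) : Isot n m u w :=
  let ⟨hu, _, e⟩ := h
  let ⟨_, hw, e'⟩ := h'
  ⟨hu, hw, e.trans e'⟩

theorem eq (h : Isot n m u v) (hu : IsTangle n u m) (hv : IsTangle n v m) : mk u hu = mk v hv :=
  let ⟨_, _, e⟩ := h
  e

theorem append (h : Isot n m u v) (h' : Isot m k x y) : Isot n k (u ++ x) (v ++ y) := by
  obtain ⟨hu, hv, e⟩ := h
  obtain ⟨hx, hy, e'⟩ := h'
  refine ⟨hu.append hx, hv.append hy, ?_⟩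
  rw [← mk_comp_mk hu hx, e, e', mk_comp_mk]

theorem append_left (h' : Isot m k x y) (hu : IsTangle n u m) : Isot n k (u ++ x) (u ++ y) :=
  (refl hu).append h'

theorem append_right (h : Isot n m u v) (hx : IsTangle m x k) : Isot n k (u ++ x) (v ++ x) :=
  h.append (refl hx)

theorem of_move (x y : Word) (h : Move u v) (h1 : IsTangle n (x ++ u ++ y) m)
    (h2 : IsTangle n (x ++ v ++ y) m) : Isot n m (x ++ u ++ y) (x ++ v ++ y) :=
  ⟨h1, h2, Quot.sound ⟨x, y, u, v, h, rfl, rfl⟩⟩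

/-- One move in an explicit diagram, whose ends are counted by computation. -/
theorem move (x y : Word) (h : Move u v) (h1 : run n (x ++ u ++ y) = some m)
    (h2 : run n (x ++ v ++ y) = some m) : Isot n m (x ++ u ++ y) (x ++ v ++ y) :=
  of_move x y h (isTangle_of_run h1) (isTangle_of_run h2)

/-- An isotopy remains one in the presence of `a` strands above and `b` strands below. -/
theorem shift (h : Isot n m u v) (a b : ℕ) :
    Isot (a + n + b) (a + m + b) (Montesinos.shift a u) (Montesinos.shift a v) := by
  obtain ⟨hu, hv, e⟩ := h
  refine ⟨hu.shift a b, hv.shift a b, ?_⟩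
  let F : TangleClass n m → TangleClass (a + n + b) (a + m + b) :=
    Quot.map (fun w => ⟨Montesinos.shift a w.1, w.2.shift a b⟩) (by
      rintro u v ⟨x, y, p, q, h, h1, h2⟩
      exact ⟨Montesinos.shift a x, Montesinos.shift a y, _, _, h.shift a,
        by simp [h1, shift_append], by simp [h2, shift_append]⟩)
  exact congrArg F e

theorem isotopic {D D' : LinkDiagram} (h : Isot 0 0 D.word D'.word) : D.Isotopic D' := by
  obtain ⟨hu, hv, e⟩ := h
  have h := Quot.eqvGen_exact e
  have key : ∀ a b : Diagram 0 0, Relation.EqvGen Diagram.Step a b →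
      LinkDiagram.Isotopic ⟨a.1, a.2⟩ ⟨b.1, b.2⟩ := by
    intro a b h
    induction h with
    | rel a b h =>
      obtain ⟨x, y, u, v, h⟩ := h
      exact .rel _ _ ⟨x, y, u, v, h⟩
    | refl a => exact .refl _
    | symm a b _ ih => exact ih.symm
    | trans a b c _ _ ih ih' => exact ih.trans _ _ _ ih'
  exact key _ _ h

end Isot

/-- A piece may be moved horizontally past a diagram that lies above it. -/
theorem isot_interchange {n m : ℕ} {u : Word} (hu : IsTangle n u m) (g : Gen) (d b : ℕ) :
    Isot (n + d + g.ins + b) (m + d + g.outs + b) (u ++ [⟨g, m + d⟩]) (⟨g, n + d⟩ :: u) := by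
  have hg : ∀ a : ℕ, IsTangle (a + d + g.ins + b) [⟨g, a + d⟩] (a + d + g.outs + b) :=
    fun a => ⟨_, ⟨b, rfl, rfl⟩, rfl⟩
  induction u generalizing n with
  | nil =>
    cases hu
    exact Isot.refl (hg _)
  | cons l u ih =>
    obtain ⟨j, ⟨c, h1, h2⟩, hu⟩ := hu
    have hl : ∀ c' : ℕ, IsTangle (n + d + c' + b) [l] (j + d + c' + b) := fun c' =>
      ⟨_, ⟨c + d + c' + b, by omega, by omega⟩, rfl⟩
    have e1 := (ih hu).append_left (hl g.ins)
    have e2 : Isot (n + d + g.ins + b) (j + d + g.outs + b) [l, ⟨g, j + d⟩] [⟨g, n + d⟩, l] := by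
      have mv := Move.far l.gen g l.pos (c + d)
      rw [← add_assoc, ← add_assoc, ← h1, ← h2] at mv
      exact Isot.of_move [] [] mv ((hl g.ins).append (hg j)) ((hg n).append (hl g.outs))
    have hu' : IsTangle (j + d + g.outs + b) u (m + d + g.outs + b) := by
      simpa only [shift_zero, zero_add, ← add_assoc] using hu.shift 0 (d + g.outs + b)
    exact e1.trans (e2.append_right hu')

/-! ### The four-strand braid group and the flype -/

/-- Let `a`, `b`, `c` satisfy the relations of the standard generators of the four-strand braid
group.  The elements `X = a c⁻¹` and `Y = b X b⁻¹` generate a subgroup that is normalized by `a`,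
`b` and `c` (the kernel of the homomorphism to the three-strand braid group that sends `c` to `a`).
If `X` and `Y` fix a point, then `X` therefore fixes its whole orbit. -/
theorem smul_eq_smul_of_braid {G Ω : Type*} [Group G] [MulAction G Ω] {a b c : G}
    (hab : a * b * a = b * a * b) (hbc : b * c * b = c * b * c) (hac : a * c = c * a) {n : Ω}
    (h1 : a • n = c • n) (h2 : a⁻¹ • b⁻¹ • n = c⁻¹ • b⁻¹ • n) {g : G}
    (hg : g ∈ Subgroup.closure {a, b, c}) : a • g • n = c • g • n := by
  obtain ⟨X, hX⟩ : ∃ X, X = a * c⁻¹ := ⟨_, rfl⟩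
  obtain ⟨Y, hY⟩ : ∃ Y, Y = b * X * b⁻¹ := ⟨_, rfl⟩
  have hac' : a * c⁻¹ = c⁻¹ * a := by
    rw [mul_inv_eq_iff_eq_mul, mul_assoc, hac, inv_mul_cancel_left]
  -- Conjugation by `a`, `b`, `c` on the generators `X`, `Y` of the kernel.
  have aX : a * X * a⁻¹ = X := by
    rw [mul_inv_eq_iff_eq_mul, hX, mul_assoc, ← hac']
  have cX : c * X * c⁻¹ = X := by
    rw [mul_inv_eq_iff_eq_mul, hX, inv_mul_cancel_right, hac', mul_inv_cancel_left]
  have k1 : b * c⁻¹ * b⁻¹ = c⁻¹ * b⁻¹ * c := by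
    rw [mul_inv_eq_iff_eq_mul, mul_inv_eq_iff_eq_mul, mul_assoc, mul_assoc, ← mul_assoc c, ← hbc]
    group
  have k2 : b * a * b⁻¹ = a⁻¹ * b * a := by
    rw [mul_inv_eq_iff_eq_mul, mul_assoc, mul_assoc, eq_inv_mul_iff_mul_eq, ← mul_assoc, ← mul_assoc,
      hab]
  have aY : a * Y * a⁻¹ = Y * X⁻¹ := by
    have e : a * Y * a⁻¹ = (a * b * a) * c⁻¹ * b⁻¹ * a⁻¹ := by rw [hY, hX]; group
    have e' : Y * X⁻¹ = b * a * (c⁻¹ * b⁻¹ * c) * a⁻¹ := by rw [hY, hX]; group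
    rw [e, e', hab, ← k1]
    group
  have cY : c * Y * c⁻¹ = X⁻¹ * Y := by
    have e : c * Y * c⁻¹ = c * b * a * (c⁻¹ * b⁻¹ * c⁻¹) := by rw [hY, hX]; group
    have e' : X⁻¹ * Y = c * (a⁻¹ * b * a) * c⁻¹ * b⁻¹ := by rw [hY, hX]; group
    have e2 : c⁻¹ * b⁻¹ * c⁻¹ = b⁻¹ * c⁻¹ * b⁻¹ := by
      rw [← inv_inj]
      simpa [mul_assoc] using hbc.symm
    rw [e, e', e2, ← k2]
    group
  have bX : b * X * b⁻¹ = Y := hY.symm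
  have bY : b * Y * b⁻¹ = Y * X⁻¹ * Y := by
    -- Conjugate `X` by both sides of the braid relation `a b a = b a b`.
    have e : (a * b * a) * X * (a * b * a)⁻¹ = Y * X⁻¹ := by
      calc (a * b * a) * X * (a * b * a)⁻¹ = a * (b * (a * X * a⁻¹) * b⁻¹) * a⁻¹ := by group
        _ = Y * X⁻¹ := by rw [aX, bX, aY]
    have e' : (b * a * b) * X * (b * a * b)⁻¹ = b * Y * b⁻¹ * Y⁻¹ := by
      calc (b * a * b) * X * (b * a * b)⁻¹ = b * (a * (b * X * b⁻¹) * a⁻¹) * b⁻¹ := by group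
        _ = _ := by rw [bX, aY, ← conj_mul, ← conj_inv, bX]
    rw [hab] at e
    exact (mul_inv_eq_iff_eq_mul.1 (e'.symm.trans e))
  let K := Subgroup.closure {X, Y}
  have XK : X ∈ K := Subgroup.subset_closure (by simp)
  have YK : Y ∈ K := Subgroup.subset_closure (by simp)
  -- A conjugation that maps `X` and `Y` into `K` and hits both of them maps `K` onto `K`.
  have norm : ∀ d : G, d * X * d⁻¹ ∈ K → d * Y * d⁻¹ ∈ K → (∃ k ∈ K, d * k * d⁻¹ = X) →
      (∃ k ∈ K, d * k * d⁻¹ = Y) → d ∈ Subgroup.normalizer (K : Set G) := by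
    rintro d dX dY ⟨x, xK, hx⟩ ⟨y, yK, hy⟩
    have le : K ≤ K.comap (MulAut.conj d).toMonoidHom := by
      rw [Subgroup.closure_le]
      rintro k (rfl | rfl)
      exacts [dX, dY]
    have ge : K ≤ K.comap (MulAut.conj d).symm.toMonoidHom := by
      rw [Subgroup.closure_le]
      rintro k (rfl | rfl)
      · simpa [← hx, mul_assoc] using xK
      · simpa [← hy, mul_assoc] using yK
    refine Subgroup.mem_normalizer_iff.2 fun k => ⟨fun hk => le hk, fun hk => ?_⟩
    simpa [mul_assoc] using ge hk
  have le : Subgroup.closure {a, b, c} ≤ Subgroup.normalizer (K : Set G) := by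
    rw [Subgroup.closure_le]
    rintro d (rfl | rfl | rfl)
    · refine norm _ (aX.symm ▸ XK) (aY ▸ K.mul_mem YK (K.inv_mem XK)) ⟨X, XK, aX⟩
        ⟨Y * X, K.mul_mem YK XK, ?_⟩
      rw [← conj_mul, aX, aY, inv_mul_cancel_right]
    · refine norm _ (bX ▸ YK) (bY ▸ K.mul_mem (K.mul_mem YK (K.inv_mem XK)) YK)
        ⟨X * Y⁻¹ * X, K.mul_mem (K.mul_mem XK (K.inv_mem YK)) XK, ?_⟩ ⟨X, XK, bX⟩
      rw [← conj_mul, ← conj_mul, ← conj_inv, bX, bY]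
      group
    · refine norm _ (cX.symm ▸ XK) (cY ▸ K.mul_mem (K.inv_mem XK) YK) ⟨X, XK, cX⟩
        ⟨X * Y, K.mul_mem XK YK, ?_⟩
      rw [← conj_mul, cX, cY, mul_inv_cancel_left]
  -- The hypotheses on the point `n` say that `X` and `Y` fix it.
  have fix : K ≤ MulAction.stabilizer G n := by
    have Xn : X • n = n := by
      rw [hX, hac', mul_smul, h1, inv_smul_smul]
    rw [Subgroup.closure_le]
    rintro k (hk | hk)
    · rw [hk]
      exact Xn
    · rw [hk]
      change Y • n = n
      rw [hY, hX, mul_smul, mul_smul, mul_smul, ← h2, smul_inv_smul, smul_inv_smul]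
  have hk : g⁻¹ * X * g ∈ K := by
    simpa using (Subgroup.mem_normalizer_iff.1 (inv_mem (le hg)) X).1 XK
  have hk' : g⁻¹ • X • g • n = n := by
    simpa [mul_smul] using MulAction.mem_stabilizer_iff.1 (fix hk)
  have hX' : X • g • n = g • n := by rw [← inv_smul_eq_iff, hk']
  rw [hX, hac', mul_smul, inv_smul_eq_iff] at hX'
  exact hX'

/-! ### Rational tangles as braided pairs of arcs -/

/-- A crossing of the strands `k` and `k + 1` of four strands. -/
def crossing (k : Fin 3) (s : Bool) : TangleClass 4 4 :=
  mk [⟨.cross s, k⟩] ⟨4, ⟨2 - k, by simp only [Gen.ins]; omega, by simp only [Gen.outs]; omega⟩, rfl⟩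

theorem crossing_mul_crossing_not (k : Fin 3) (s : Bool) : crossing k s * crossing k (!s) = 1 := by
  fin_cases k <;> exact (Isot.move [] [] (Move.r2 s _) rfl rfl : Isot 4 4 _ _).eq _ _

/-- The permutation of tangles with four right ends that adds a crossing of the ends `k` and
`k + 1`. -/
def twist (k : Fin 3) (s : Bool) : Equiv.Perm (TangleClass 0 4) where
  toFun x := x.comp (crossing k s)
  invFun x := x.comp (crossing k (!s))
  left_inv x := by
    change (x.comp _).comp _ = x
    rw [comp_assoc]
    exact (congrArg x.comp (crossing_mul_crossing_not k s)).trans (comp_nil x)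
  right_inv x := by
    have h := crossing_mul_crossing_not k (!s)
    rw [Bool.not_not] at h
    change (x.comp _).comp _ = x
    rw [comp_assoc]
    exact (congrArg x.comp h).trans (comp_nil x)

theorem twist_mk (k : Fin 3) (s : Bool) {w : Word} (hw : IsTangle 0 w 4) :
    twist k s (mk w hw) = mk (w ++ [⟨.cross s, k⟩])
      (hw.append ⟨4, ⟨2 - k, by simp only [Gen.ins]; omega, by simp only [Gen.outs]; omega⟩, rfl⟩) :=
  rfl

theorem twist_not (k : Fin 3) (s : Bool) : twist k (!s) = (twist k s)⁻¹ := by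
  ext x
  rfl

theorem twist_not_twist (k : Fin 3) (s : Bool) (x : TangleClass 0 4) :
    twist k (!s) (twist k s x) = x :=
  (twist k s).left_inv x

/-- Isotopies of the right ends of a tangle. -/
theorem mk_append_eq {n m k : ℕ} {w u v : Word} (hw : IsTangle n w m) (h : Isot m k u v)
    (hu : IsTangle n (w ++ u) k) (hv : IsTangle n (w ++ v) k) : mk (w ++ u) hu = mk (w ++ v) hv :=
  (h.append_left hw).eq _ _

theorem twist_braid (k k' : Fin 3) (h : (k' : ℕ) = k + 1) (s : Bool) :
    twist k s * twist k' s * twist k s = twist k' s * twist k s * twist k' s := by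
  ext x
  induction x using TangleClass.ind with
  | h w hw =>
    simp only [Equiv.Perm.mul_apply, twist_mk, List.append_assoc]
    refine mk_append_eq hw ?_ _ _
    have mv := Move.r3 s k
    rw [← h] at mv
    have hk : (k : ℕ) = 0 ∨ (k : ℕ) = 1 := by omega
    rcases hk with hk | hk <;> rw [hk] at mv h <;> rw [hk, h] <;> rw [h] at mv <;>
      exact Isot.move [] [] mv rfl rfl

theorem twist_zero_two (s s' : Bool) : twist 0 s * twist 2 s' = twist 2 s' * twist 0 s := by
  ext x
  induction x using TangleClass.ind with
  | h w hw =>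
    simp only [Equiv.Perm.mul_apply, twist_mk, List.append_assoc]
    have h : Isot 4 4 [⟨.cross s, 0⟩, ⟨.cross s', 2⟩] [⟨.cross s', 2⟩, ⟨.cross s, 0⟩] :=
      .move [] [] (.far (.cross s) (.cross s') 0 0) rfl rfl
    exact mk_append_eq hw h.symm _ _

/-- The tangle `∞` with its ends NE, SE, SW, NW on the right, in this order. -/
def inftyArcs : TangleClass 0 4 := mk [⟨.birth, 0⟩, ⟨.birth, 2⟩] (isTangle_of_run rfl)

/-- The tangle `0` with its ends NE, SE, SW, NW on the right, in this order. -/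
def zeroArcs : TangleClass 0 4 := mk [⟨.birth, 0⟩, ⟨.birth, 1⟩] (isTangle_of_run rfl)

theorem isot_births : Isot 0 4 [⟨.birth, 0⟩, ⟨.birth, 2⟩] [⟨.birth, 0⟩, ⟨.birth, 0⟩] :=
  .move [] [] (.far .birth .birth 0 0) rfl rfl

theorem twist_zero_inftyArcs (s : Bool) : twist 0 s inftyArcs = inftyArcs := by
  refine Isot.eq ?_ _ _
  have h := isot_births.append_right (x := [⟨.cross s, 0⟩]) (k := 4) (isTangle_of_run rfl)
  exact (h.trans (.move [⟨.birth, 0⟩] [] (.r1Birth s 0) rfl rfl)).trans isot_births.symm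

theorem twist_two_inftyArcs (s : Bool) : twist 2 s inftyArcs = inftyArcs :=
  (Isot.move [⟨.birth, 0⟩] [] (.r1Birth s 2) rfl rfl : Isot 0 4 _ _).eq _ _

theorem twist_one_zeroArcs (s : Bool) : twist 1 s zeroArcs = zeroArcs :=
  (Isot.move [⟨.birth, 0⟩] [] (.r1Birth s 1) rfl rfl : Isot 0 4 _ _).eq _ _

/-- A crossing of the two arcs of `∞` slides along one of them and becomes a crossing on the
right of `0`. -/
theorem twist_one_inftyArcs (s : Bool) : twist 1 s inftyArcs = twist 0 (!s) zeroArcs := by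
  refine Isot.eq ?_ _ _
  have h := isot_births.append_right (x := [⟨.cross s, 1⟩]) (k := 4) (isTangle_of_run rfl)
  have h' : Isot 0 4 [⟨.birth, 0⟩, ⟨.birth, 1⟩, ⟨.cross (!s), 0⟩]
      [⟨.birth, 0⟩, ⟨.birth, 0⟩, ⟨.cross (!!s), 1⟩] :=
    .move [⟨.birth, 0⟩] [] (.slideBirth (!s) 0) rfl rfl
  rw [Bool.not_not] at h'
  exact h.trans h'.symm

/-- Along the other arc, it becomes a crossing on the left of `0`. -/
theorem twist_one_inftyArcs' (s : Bool) : twist 1 s inftyArcs = twist 2 (!s) zeroArcs :=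
  (Isot.move [⟨.birth, 0⟩] [] (.slideBirth s 1) rfl rfl : Isot 0 4 _ _).eq _ _

/-- The rational tangles: the four-strand braid group acts on the ends of `∞`. -/
def rationalTangles : Set (TangleClass 0 4) :=
  {x | ∃ g ∈ Subgroup.closure {twist 0 true, twist 1 true, twist 2 true}, x = g inftyArcs}

theorem inftyArcs_mem : inftyArcs ∈ rationalTangles := ⟨1, one_mem _, rfl⟩

theorem twist_mem {x : TangleClass 0 4} (hx : x ∈ rationalTangles) (k : Fin 3) (s : Bool) :
    twist k s x ∈ rationalTangles := by
  obtain ⟨g, hg, rfl⟩ := hx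
  refine ⟨twist k s * g, mul_mem ?_ hg, rfl⟩
  have h : twist k true ∈ Subgroup.closure {twist 0 true, twist 1 true, twist 2 true} := by
    refine Subgroup.subset_closure ?_
    fin_cases k <;> simp
  cases s
  · rw [← Bool.not_true, twist_not]
    exact inv_mem h
  · exact h

theorem zeroArcs_mem : zeroArcs ∈ rationalTangles := by
  have h := twist_mem (twist_mem inftyArcs_mem 1 true) 0 true
  rw [twist_one_inftyArcs] at h
  exact twist_not_twist 0 false zeroArcs ▸ h

/-- A crossing of the right ends NE, SE of a rational tangle may be moved to the left ends. -/
theorem twist_zero_eq_twist_two {x : TangleClass 0 4} (hx : x ∈ rationalTangles) (s : Bool) :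
    twist 0 s x = twist 2 s x := by
  have key : ∀ y ∈ rationalTangles, twist 0 true y = twist 2 true y := by
    rintro y ⟨g, hg, rfl⟩
    refine smul_eq_smul_of_braid (n := inftyArcs) (twist_braid 0 1 rfl true)
      (twist_braid 1 2 rfl true) (twist_zero_two true true) ?_ ?_ hg
    · simp only [Equiv.Perm.smul_def, twist_zero_inftyArcs, twist_two_inftyArcs]
    · simp only [Equiv.Perm.smul_def, ← twist_not, Bool.not_true]
      refine (?_ : _ = zeroArcs).trans (Eq.symm ?_)
      · rw [twist_one_inftyArcs]
        exact twist_not_twist 0 true zeroArcs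
      · rw [twist_one_inftyArcs']
        exact twist_not_twist 2 true zeroArcs
  cases s
  -- For negative crossings, apply the positive case to the tangle with such a crossing added.
  · have h := key _ (twist_mem hx 0 false)
    rw [← twist_not_twist 2 true (twist 0 false x), ← h]
    exact congrArg _ (twist_not_twist 0 false x)
  · exact key x hx

theorem IsTangle.bend {w : Word} (hw : IsTangle 0 w 4) :
    IsTangle 2 (w ++ [⟨.death, 3⟩, ⟨.death, 2⟩]) 2 := by
  have h := hw.shift 0 2
  rw [shift_zero] at h
  exact IsTangle.append h (isTangle_of_run rfl)

/-- Bend the last two right ends SW, NW of a tangle to the left, below the tangle. -/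
def bend : TangleClass 0 4 → TangleClass 2 2 :=
  Quot.map (fun w => ⟨w.1 ++ [⟨.death, 3⟩, ⟨.death, 2⟩], w.2.bend⟩) (by
    rintro u v ⟨x, y, a, b, h, h1, h2⟩
    exact ⟨x, y ++ [⟨.death, 3⟩, ⟨.death, 2⟩], a, b, h, by simp [h1], by simp [h2]⟩)

theorem bend_mk {w : Word} (hw : IsTangle 0 w 4) :
    bend (mk w hw) = mk (w ++ [⟨.death, 3⟩, ⟨.death, 2⟩]) hw.bend := rfl

/-- The tangle that consists of one crossing. -/
def oneCrossing (s : Bool) : TangleClass 2 2 := mk [⟨.cross s, 0⟩] (isTangle_of_run rfl)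

theorem oneCrossing_mul_not (s : Bool) : oneCrossing s * oneCrossing (!s) = 1 :=
  (Isot.move [] [] (.r2 s 0) rfl rfl : Isot 2 2 _ _).eq _ _

/-- A crossing of the first two ends, NE and SE, is a crossing added on the right. -/
theorem bend_twist_zero (x : TangleClass 0 4) (s : Bool) :
    bend (twist 0 s x) = bend x * oneCrossing s := by
  induction x using TangleClass.ind with
  | h w hw =>
    refine Isot.eq ?_ _ _
    have hw' : IsTangle 2 w 6 := by simpa [shift_zero] using hw.shift 0 2
    have h1 : Isot 6 2 [⟨.cross s, 0⟩, ⟨.death, 3⟩, ⟨.death, 2⟩]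
        [⟨.death, 3⟩, ⟨.cross s, 0⟩, ⟨.death, 2⟩] :=
      .move [] [⟨.death, 2⟩] (.far (.cross s) .death 0 1) rfl rfl
    have h2 : Isot 6 2 [⟨.death, 3⟩, ⟨.cross s, 0⟩, ⟨.death, 2⟩]
        [⟨.death, 3⟩, ⟨.death, 2⟩, ⟨.cross s, 0⟩] :=
      .move [⟨.death, 3⟩] [] (.far (.cross s) .death 0 0) rfl rfl
    simpa using (h1.trans h2).append_left hw'

/-- A crossing of the ends SW and NW is a crossing added on the left. -/
theorem bend_twist_two (x : TangleClass 0 4) (s : Bool) :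
    bend (twist 2 s x) = oneCrossing s * bend x := by
  induction x using TangleClass.ind with
  | h w hw =>
    refine Isot.eq ?_ _ _
    have hw' : IsTangle 2 w 6 := by simpa [shift_zero] using hw.shift 0 2
    have h0 : Isot 2 2 (w ++ [⟨.cross s, 4⟩] ++ [⟨.death, 3⟩, ⟨.death, 2⟩])
        (⟨.cross s, 0⟩ :: w ++ [⟨.death, 3⟩, ⟨.death, 2⟩]) :=
      (isot_interchange hw (.cross s) 0 0 : Isot 2 6 _ _).append_right (isTangle_of_run rfl)
    have h1 : Isot 6 2 [⟨.cross s, 2⟩, ⟨.death, 3⟩, ⟨.death, 2⟩]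
        [⟨.cross (!s), 3⟩, ⟨.death, 2⟩, ⟨.death, 2⟩] :=
      .move [] [⟨.death, 2⟩] (.slideDeath s 2) rfl rfl
    have h2 : Isot 6 2 [⟨.cross (!s), 3⟩, ⟨.death, 2⟩, ⟨.death, 2⟩]
        [⟨.cross (!s), 3⟩, ⟨.death, 4⟩, ⟨.death, 2⟩] :=
      .move [⟨.cross (!s), 3⟩] [] (.far .death .death 2 0) rfl rfl
    have h3 : Isot 6 2 [⟨.cross s, 4⟩, ⟨.death, 3⟩, ⟨.death, 2⟩]
        [⟨.cross (!s), 3⟩, ⟨.death, 4⟩, ⟨.death, 2⟩] := by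
      have h : Isot 6 2 [⟨.cross (!s), 3⟩, ⟨.death, 4⟩, ⟨.death, 2⟩]
          [⟨.cross (!!s), 4⟩, ⟨.death, 3⟩, ⟨.death, 2⟩] :=
        .move [] [⟨.death, 2⟩] (.slideDeath (!s) 3) rfl rfl
      rw [Bool.not_not] at h
      exact h.symm
    have h4 := ((h1.trans h2).trans h3.symm).append_left hw'
    simp only [List.append_assoc, List.cons_append, List.nil_append] at h0 h4 ⊢
    exact h4.trans h0

theorem bend_zeroArcs : bend zeroArcs = 1 := by
  refine Isot.eq ?_ _ _
  have h1 : Isot 2 2 [⟨.birth, 0⟩, ⟨.birth, 1⟩, ⟨.death, 3⟩, ⟨.death, 2⟩]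
      [⟨.birth, 0⟩, ⟨.death, 1⟩, ⟨.birth, 1⟩, ⟨.death, 2⟩] :=
    .move [⟨.birth, 0⟩] [⟨.death, 2⟩] (.far .birth .death 1 0) rfl rfl
  have h2 : Isot 2 2 [⟨.birth, 0⟩, ⟨.death, 1⟩, ⟨.birth, 1⟩, ⟨.death, 2⟩]
      [⟨.birth, 1⟩, ⟨.death, 2⟩] :=
    .move [] [⟨.birth, 1⟩, ⟨.death, 2⟩] (.zagzig 0) rfl rfl
  have h3 : Isot 2 2 [⟨.birth, 1⟩, ⟨.death, 2⟩] [] := .move [] [] (.zagzig 1) rfl rfl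
  exact (h1.trans h2).trans h3

theorem bend_inftyArcs : bend inftyArcs = mk Tangle.infty.word Tangle.infty.isTangle_word := by
  refine Isot.eq ?_ _ _
  have h1 : Isot 2 2 [⟨.birth, 0⟩, ⟨.birth, 2⟩, ⟨.death, 3⟩, ⟨.death, 2⟩]
      [⟨.birth, 0⟩, ⟨.death, 2⟩] :=
    .move [⟨.birth, 0⟩] [⟨.death, 2⟩] (.zagzig 2) rfl rfl
  have h2 : Isot 2 2 [⟨.birth, 0⟩, ⟨.death, 2⟩] [⟨.death, 0⟩, ⟨.birth, 0⟩] :=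
    .move [] [] (.far .birth .death 0 0) rfl rfl
  exact h1.trans h2

theorem IsTangle.stack {u v : Word} (hu : IsTangle 2 u 2) (hv : IsTangle 2 v 2) :
    IsTangle 2 ([⟨.birth, 1⟩] ++ u ++ Montesinos.shift 2 v ++ [⟨.death, 1⟩]) 2 := by
  have hu' : IsTangle 4 u 4 := by simpa [shift_zero] using hu.shift 0 2
  have hv' : IsTangle 4 (Montesinos.shift 2 v) 4 := hv.shift 2 0
  have h0 : IsTangle 2 [⟨.birth, 1⟩] 4 := isTangle_of_run rfl
  exact ((h0.append hu').append hv').append (isTangle_of_run rfl)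

/-- Placing two tangles on top of each other. -/
def stack : TangleClass 2 2 → TangleClass 2 2 → TangleClass 2 2 :=
  Quot.map₂ (fun u v => ⟨[⟨.birth, 1⟩] ++ u.1 ++ shift 2 v.1 ++ [⟨.death, 1⟩], u.2.stack v.2⟩)
    (by
      rintro u v v' ⟨x, y, a, b, h, h1, h2⟩
      exact ⟨[⟨.birth, 1⟩] ++ u.1 ++ shift 2 x, shift 2 y ++ [⟨.death, 1⟩], _, _, h.shift 2,
        by simp [h1, shift_append], by simp [h2, shift_append]⟩)
    (by
      rintro u u' v ⟨x, y, a, b, h, h1, h2⟩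
      exact ⟨[⟨.birth, 1⟩] ++ x, y ++ shift 2 v.1 ++ [⟨.death, 1⟩], _, _, h,
        by simp [h1], by simp [h2]⟩)

/-- The isotopy class of a tangle in Conway's notation. -/
def Tangle.cls (t : Tangle) : TangleClass 2 2 := mk t.word t.isTangle_word

theorem Tangle.cls_add (s t : Tangle) : (s.add t).cls = s.cls * t.cls := rfl

theorem Tangle.cls_stack (s t : Tangle) : (s.stack t).cls = Montesinos.stack s.cls t.cls := rfl

/-- The tangle `∞` is neutral for stacking. -/
theorem stack_infty (x : TangleClass 2 2) : stack x Tangle.infty.cls = x := by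
  induction x using TangleClass.ind with
  | h u hu =>
    refine Isot.eq ?_ _ _
    have hu' : IsTangle 4 u 4 := by simpa [shift_zero] using hu.shift 0 2
    have h0 : IsTangle 2 [⟨.birth, 1⟩] 4 := isTangle_of_run rfl
    have h1 : Isot 4 2 [⟨.death, 2⟩, ⟨.birth, 2⟩, ⟨.death, 1⟩] [⟨.death, 2⟩] :=
      .move [⟨.death, 2⟩] [] (.zigzag 1) rfl rfl
    have h2 : Isot 4 2 (u ++ [⟨.death, 2⟩]) (⟨.death, 2⟩ :: u) := isot_interchange hu .death 0 0
    have h3 : Isot 2 2 [⟨.birth, 1⟩, ⟨.death, 2⟩] [] := .move [] [] (.zagzig 1) rfl rfl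
    have e1 := h1.append_left (h0.append hu')
    have e2 := h2.append_left h0
    have e3 := h3.append_right hu
    simp only [List.cons_append, List.nil_append] at e1 e2 e3
    simpa [shift, Tangle.word] using (e1.trans e2).trans e3

/-- Stacking is associative; the case in which the lowest tangle is a crossing suffices. -/
theorem stack_stack_oneCrossing (x y : TangleClass 2 2) (s : Bool) :
    stack x (stack y (oneCrossing s)) = stack (stack x y) (oneCrossing s) := by
  induction x using TangleClass.ind with
  | h u hu =>
  induction y using TangleClass.ind with
  | h v hv =>
    refine Isot.eq ?_ _ _
    have hu' : IsTangle 6 u 6 := by simpa [shift_zero] using hu.shift 0 4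
    have hv' : IsTangle 6 (shift 2 v) 6 := hv.shift 2 2
    have h0 : IsTangle 2 [⟨.birth, 1⟩] 4 := isTangle_of_run rfl
    have h1 : Isot 4 6 (u ++ [⟨.birth, 3⟩]) (⟨.birth, 3⟩ :: u) := isot_interchange hu .birth 1 1
    have h2 : Isot 2 6 [⟨.birth, 1⟩, ⟨.birth, 3⟩] [⟨.birth, 1⟩, ⟨.birth, 1⟩] :=
      .move [] [] (.far .birth .birth 1 0) rfl rfl
    have h3 : Isot 6 2 [⟨.death, 1⟩, ⟨.cross s, 2⟩, ⟨.death, 1⟩]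
        [⟨.cross s, 4⟩, ⟨.death, 1⟩, ⟨.death, 1⟩] :=
      .move [] [⟨.death, 1⟩] (.far .death (.cross s) 1 1) rfl rfl
    have h4 : Isot 6 2 [⟨.cross s, 4⟩, ⟨.death, 1⟩, ⟨.death, 1⟩]
        [⟨.cross s, 4⟩, ⟨.death, 3⟩, ⟨.death, 1⟩] :=
      .move [⟨.cross s, 4⟩] [] (.far .death .death 1 0) rfl rfl
    have e1 := ((h1.append_left h0).trans (h2.append_right hu')).append
      ((h3.trans h4).symm.append_left hv')
    simpa [shift, Function.comp_def] using e1

/-- A crossing of the ends SE and SW is a crossing added below. -/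
theorem stack_bend_oneCrossing (x : TangleClass 0 4) (s : Bool) :
    stack (bend x) (oneCrossing s) = bend (twist 1 (!s) x) := by
  induction x using TangleClass.ind with
  | h w hw =>
    refine Isot.eq ?_ _ _
    have hw' : IsTangle 2 w 6 := by simpa [shift_zero] using hw.shift 0 2
    have h0 : Isot 2 8 (w ++ [⟨.birth, 5⟩]) (⟨.birth, 1⟩ :: w) := isot_interchange hw .birth 1 1
    have h1 : Isot 6 2 [⟨.birth, 5⟩, ⟨.death, 3⟩, ⟨.death, 2⟩, ⟨.cross s, 2⟩, ⟨.death, 1⟩]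
        [⟨.death, 3⟩, ⟨.birth, 3⟩, ⟨.death, 2⟩, ⟨.cross s, 2⟩, ⟨.death, 1⟩] :=
      (Isot.move [] [⟨.death, 2⟩, ⟨.cross s, 2⟩, ⟨.death, 1⟩] (.far .death .birth 3 0) rfl rfl :
        Isot 6 2 _ _).symm
    have h2 : Isot 6 2 [⟨.death, 3⟩, ⟨.birth, 3⟩, ⟨.death, 2⟩, ⟨.cross s, 2⟩, ⟨.death, 1⟩]
        [⟨.death, 3⟩, ⟨.cross s, 2⟩, ⟨.death, 1⟩] :=
      .move [⟨.death, 3⟩] [⟨.cross s, 2⟩, ⟨.death, 1⟩] (.zigzag 2) rfl rfl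
    have h3 : Isot 6 2 [⟨.death, 3⟩, ⟨.cross (!s), 1⟩, ⟨.death, 2⟩]
        [⟨.death, 3⟩, ⟨.cross (!!s), 2⟩, ⟨.death, 1⟩] :=
      .move [⟨.death, 3⟩] [] (.slideDeath (!s) 1) rfl rfl
    rw [Bool.not_not] at h3
    have h4 : Isot 6 2 [⟨.cross (!s), 1⟩, ⟨.death, 3⟩, ⟨.death, 2⟩]
        [⟨.death, 3⟩, ⟨.cross (!s), 1⟩, ⟨.death, 2⟩] :=
      .move [] [⟨.death, 2⟩] (.far (.cross (!s)) .death 1 0) rfl rfl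
    have e1 := h0.append_right (x := [⟨.death, 3⟩, ⟨.death, 2⟩, ⟨.cross s, 2⟩, ⟨.death, 1⟩]) (k := 2)
      (isTangle_of_run rfl)
    have e2 := (((h1.trans h2).trans h3.symm).trans h4.symm).append_left hw'
    simp only [List.append_assoc, List.cons_append, List.nil_append] at e1 e2
    simpa [shift] using e1.symm.trans e2

/-- The flype: crossings may be moved past a rational tangle. -/
theorem commute_bend_oneCrossing {x : TangleClass 0 4} (hx : x ∈ rationalTangles) (s : Bool) :
    Commute (bend x) (oneCrossing s) := by
  rw [Commute, SemiconjBy, ← bend_twist_zero, ← bend_twist_two, twist_zero_eq_twist_two hx]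

/-! ### Alternating twists and the change of sign -/

/-- Tangles that arise from the tangle `0` by adding crossings of sign `s` on the right and below,
the first one on the right.  (A crossing below the tangle of sign `s` is a crossing of the ends SE
and SW which, seen with both ends on the right, has the sign `!s`.) -/
inductive AltTwists (s : Bool) : TangleClass 0 4 → Prop
  | start : AltTwists s (twist 0 s zeroArcs)
  | addRight {x : TangleClass 0 4} (h : AltTwists s x) : AltTwists s (twist 0 s x)
  | stackBelow {x : TangleClass 0 4} (h : AltTwists s x) : AltTwists s (twist 1 (!s) x)

theorem AltTwists.mem {s : Bool} {x : TangleClass 0 4} (h : AltTwists s x) :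
    x ∈ rationalTangles := by
  induction h with
  | start => exact twist_mem zeroArcs_mem _ _
  | addRight _ ih => exact twist_mem ih _ _
  | stackBelow _ ih => exact twist_mem ih _ _

theorem AltTwists.addRight_iterate {s : Bool} {x : TangleClass 0 4} (h : AltTwists s x) (a : ℕ) :
    AltTwists s ((twist 0 s)^[a] x) := by
  induction a with
  | zero => exact h
  | succ a ih =>
    rw [Function.iterate_succ_apply']
    exact ih.addRight

theorem AltTwists.stackBelow_iterate {s : Bool} {x : TangleClass 0 4} (h : AltTwists s x) (a : ℕ) :
    AltTwists s ((twist 1 (!s))^[a] x) := by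
  induction a with
  | zero => exact h
  | succ a ih =>
    rw [Function.iterate_succ_apply']
    exact ih.stackBelow

/-- The relation `a⁻¹ b a = b a b⁻¹` of the three-strand braid group, for the generators or for
their inverses, as an action on tangles. -/
theorem twist_braid_apply (s : Bool) (x : TangleClass 0 4) :
    twist 0 (!s) (twist 1 (!s) (twist 0 s x)) = twist 1 s (twist 0 (!s) (twist 1 (!s) x)) := by
  have h := DFunLike.congr_fun (twist_braid 0 1 rfl (!s)) (twist 0 s x)
  simp only [Equiv.Perm.mul_apply, twist_not_twist] at h
  have h' := twist_not_twist 1 (!s) (twist 0 (!s) (twist 1 (!s) (twist 0 s x)))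
  rw [Bool.not_not] at h'
  rw [h, h']

/-- The rational tangles of sign `s` and fraction of absolute value less than one. -/
def IsRationalBlock (s : Bool) (q : TangleClass 2 2) : Prop :=
  ∃ x, AltTwists s x ∧ q = bend (twist 1 (!s) x)

theorem IsRationalBlock.commute {s : Bool} {q : TangleClass 2 2} (h : IsRationalBlock s q)
    (s' : Bool) : Commute q (oneCrossing s') := by
  obtain ⟨x, hx, rfl⟩ := h
  exact commute_bend_oneCrossing (twist_mem hx.mem _ _) s'

/-- A crossing of the opposite sign changes the sign of a block: if the fraction is
`-r ∈ (-1, 0)`, then `1 - r ∈ (0, 1)`. -/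
theorem IsRationalBlock.mul_oneCrossing {s : Bool} {q : TangleClass 2 2}
    (h : IsRationalBlock s q) : IsRationalBlock (!s) (q * oneCrossing (!s)) := by
  obtain ⟨x, hx, rfl⟩ := h
  -- The two crossings, with a compensating twist, pass through the twists of `x` one after the
  -- other and exchange those on the right with those below.
  have key : ∃ y, AltTwists (!s) y ∧ twist 0 (!s) (twist 1 (!s) x) = twist 1 s y := by
    induction hx with
    | start => exact ⟨_, .start, by rw [twist_braid_apply, twist_one_zeroArcs]⟩
    | addRight h ih =>
      obtain ⟨y, hy, e⟩ := ih
      refine ⟨_, hy.stackBelow, ?_⟩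
      rw [twist_braid_apply, e, Bool.not_not]
    | @stackBelow x h ih =>
      obtain ⟨y, hy, e⟩ := ih
      refine ⟨_, hy.addRight, ?_⟩
      have h1 := twist_braid_apply s (twist 0 (!s) (twist 1 (!s) x))
      have h2 := twist_not_twist 0 (!s) (twist 1 (!s) x)
      rw [Bool.not_not] at h2
      rw [h2, e, twist_not_twist] at h1
      exact h1
  obtain ⟨y, hy, e⟩ := key
  refine ⟨y, hy, ?_⟩
  rw [← bend_twist_zero, e, Bool.not_not]

/-! ### Rational tangles in Conway's notation -/

/-- The tangle `1` or `-1`. -/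
def Tangle.unit (s : Bool) : Tangle := if s then one else negOne

theorem Tangle.cls_unit (s : Bool) : (unit s).cls = oneCrossing s := by
  cases s <;> rfl

theorem Tangle.reflect_unit (s : Bool) : (unit s).reflect = unit s := by
  cases s <;> rfl

theorem Tangle.reflect_reflect (t : Tangle) : t.reflect.reflect = t := by
  induction t <;> simp_all [reflect]

theorem Tangle.cls_copies (s : Bool) (a : ℕ) : ((unit s).copies a).cls = oneCrossing s ^ a := by
  induction a with
  | zero => rfl
  | succ a ih => rw [copies, cls_add, ih, cls_unit, pow_succ]

theorem bend_twist_zero_iterate (x : TangleClass 0 4) (s : Bool) (a : ℕ) :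
    bend ((twist 0 s)^[a] x) = bend x * oneCrossing s ^ a := by
  induction a with
  | zero => exact (mul_one _).symm
  | succ a ih => rw [Function.iterate_succ_apply', bend_twist_zero, ih, mul_assoc, pow_succ]

theorem Tangle.cls_reflect_copies (s : Bool) (a : ℕ) :
    ((unit s).copies a).reflect.cls = bend ((twist 1 (!s))^[a] inftyArcs) := by
  induction a with
  | zero => exact bend_inftyArcs.symm
  | succ a ih =>
    rw [copies, reflect, cls_stack, ih, reflect_unit, cls_unit, stack_bend_oneCrossing,
      Function.iterate_succ_apply']

theorem stack_bend_reflect_copies (x : TangleClass 0 4) (s : Bool) (a : ℕ) :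
    stack (bend x) ((Tangle.unit s).copies a).reflect.cls = bend ((twist 1 (!s))^[a] x) := by
  induction a with
  | zero => exact stack_infty _
  | succ a ih =>
    rw [Tangle.copies, Tangle.reflect, Tangle.cls_stack, Tangle.reflect_unit, Tangle.cls_unit,
      stack_stack_oneCrossing, ih, stack_bend_oneCrossing, Function.iterate_succ_apply']

/-- The rational tangle `a₁ … aₘ` or `(-a₁) … (-aₘ)`, depending on the sign `s`. -/
def Tangle.ofNats (s : Bool) (l : List ℕ) : Tangle :=
  ofInts (l.map fun a : ℕ => (if s then 1 else -1) * (a : ℤ))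

theorem Tangle.int_eq (s : Bool) (a : ℕ) :
    int ((if s then 1 else -1) * (a : ℤ)) = (unit s).copies a := by
  cases s
  · cases a with
    | zero => rfl
    | succ a =>
      have h : (if false = true then 1 else -1) * ((a + 1 : ℕ) : ℤ) = Int.negSucc a := by
        simp [Int.negSucc_eq]
      rw [h]
      rfl
  · rw [if_pos rfl, one_mul]
    rfl

theorem Tangle.ofNats_singleton (s : Bool) (a : ℕ) : ofNats s [a] = (unit s).copies a :=
  int_eq s a

theorem Tangle.ofNats_append (s : Bool) {l : List ℕ} (hl : l ≠ []) (a : ℕ) :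
    ofNats s (l ++ [a]) = (ofNats s l).mul ((unit s).copies a) := by
  cases l with
  | nil => exact absurd rfl hl
  | cons b l =>
    rw [← int_eq]
    simp [ofNats, ofInts, List.foldl_append]

/-- Numbers `a₁, …, aₘ` with `a₁ ≥ 2` and `aₖ ≥ 1` for all `k`. -/
def Proper (l : List ℕ) : Prop := l ≠ [] ∧ (∀ x ∈ l.head?, 2 ≤ x) ∧ ∀ x ∈ l, 1 ≤ x

theorem Proper.of_append {l : List ℕ} {a : ℕ} (h : Proper (l ++ [a])) (hl : l ≠ []) :
    Proper l ∧ 1 ≤ a := by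
  obtain ⟨-, h1, h2⟩ := h
  rw [List.head?_append_of_ne_nil _ hl] at h1
  exact ⟨⟨hl, h1, fun x hx => h2 x (by simp [hx])⟩, h2 a (by simp)⟩

theorem Proper.one_lt_fraction {l : List ℕ} (h : Proper l) :
    1 < fraction (l.map fun a : ℕ => (a : ℤ)) := by
  induction l using List.reverseRecOn with
  | nil => exact absurd rfl h.1
  | append_singleton l a ih =>
    by_cases hl : l = []
    · subst hl
      have h2 : 2 ≤ a := h.2.1 a rfl
      simpa [fraction] using by omega
    · obtain ⟨h1, h2⟩ := h.of_append hl
      rw [List.map_append, List.map_singleton, fraction_append (by simpa using hl)]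
      have h3 := ih h1
      have h4 : (1 : ℚ) ≤ ((a : ℤ) : ℚ) := by exact_mod_cast h2
      have h5 : 0 < 1 / fraction (l.map fun a : ℕ => (a : ℤ)) := by positivity
      linarith

/-- The tangle of a proper list is a sequence of alternating twists, and its reflection is a block. -/
theorem Proper.cls {l : List ℕ} (h : Proper l) (s : Bool) :
    (∃ x, AltTwists s x ∧ (Tangle.ofNats s l).cls = bend x) ∧
      IsRationalBlock s (Tangle.ofNats s l).reflect.cls := by
  induction l using List.reverseRecOn with
  | nil => exact absurd rfl h.1
  | append_singleton l a ih =>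
    by_cases hl : l = []
    · subst hl
      obtain ⟨a, rfl⟩ : ∃ b, a = b + 2 := ⟨a - 2, by have : 2 ≤ a := h.2.1 a rfl; omega⟩
      rw [List.nil_append, Tangle.ofNats_singleton]
      -- The first crossing below `∞` is the same as a crossing on the right of `0`; since `a₁ ≥ 2`,
      -- at least one crossing below remains.
      refine ⟨⟨_, AltTwists.start.addRight_iterate (a + 1), ?_⟩, _,
        AltTwists.start.stackBelow_iterate a, ?_⟩
      · rw [Tangle.cls_copies, bend_twist_zero_iterate, bend_twist_zero, bend_zeroArcs, one_mul,
          ← pow_succ']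
      · rw [Tangle.cls_reflect_copies, Function.iterate_succ_apply, twist_one_inftyArcs,
          Bool.not_not, Function.iterate_succ_apply']
    · obtain ⟨h1, h2⟩ := h.of_append hl
      obtain ⟨a, rfl⟩ : ∃ b, a = b + 1 := ⟨a - 1, by omega⟩
      obtain ⟨⟨x, hx, ex⟩, y, hy, ey⟩ := ih h1
      rw [Tangle.ofNats_append s hl, Tangle.mul]
      refine ⟨⟨_, hy.stackBelow.addRight_iterate (a + 1), ?_⟩, _, hx.stackBelow_iterate a, ?_⟩
      · rw [Tangle.cls_add, ey, Tangle.cls_copies, bend_twist_zero_iterate]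
      · rw [Tangle.reflect, Tangle.reflect_reflect, Tangle.cls_stack, ex,
          stack_bend_reflect_copies, Function.iterate_succ_apply']

/-- The tangle `1` as an invertible element, with the inverse `-1`, of the monoid of tangles. -/
def crossingUnit : (TangleClass 2 2)ˣ where
  val := oneCrossing true
  inv := oneCrossing false
  val_inv := oneCrossing_mul_not true
  inv_val := oneCrossing_mul_not false

theorem oneCrossing_true_pow (a : ℕ) :
    oneCrossing true ^ a = ↑(crossingUnit ^ (a : ℤ)) := by
  rw [zpow_natCast, Units.val_pow_eq_pow_val]
  rfl

theorem oneCrossing_false_pow (a : ℕ) :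
    oneCrossing false ^ a = ↑(crossingUnit ^ (-(a : ℤ))) := by
  rw [zpow_neg, zpow_natCast, ← inv_pow, Units.val_pow_eq_pow_val]
  rfl

theorem Tangle.cls_int (e : ℤ) : (int e).cls = ↑(crossingUnit ^ e) := by
  cases e with
  | ofNat a => exact (cls_copies true a).trans (oneCrossing_true_pow a)
  | negSucc a => exact (cls_copies false (a + 1)).trans (oneCrossing_false_pow (a + 1))

/-- The tangle `t0` for `t = ±α/β`: a block of fraction less than one, and as many crossings as
the integral part of `β/α` tells. -/
theorem cls_reflect_ofNats_euclid (s : Bool) {α β : ℕ} (hc : α.Coprime β) (h0 : α ≠ 0)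
    (hβ : β ≠ 0) (h1 : ¬ (α = 1 ∧ β = 1)) :
    ∃ (q : TangleClass 2 2) (f : ℕ),
      (Tangle.ofNats s (euclid α β)).reflect.cls = q * oneCrossing s ^ f ∧
      ((IsRationalBlock s q ∧ ∃ r : ℚ, 0 < r ∧ r < 1 ∧ (β : ℚ) / α = f + r) ∨
        (q = 1 ∧ (β : ℚ) / α = f)) := by
  obtain ⟨i1, i2, i3, i4⟩ := euclid_spec β α hc h0 hβ h1
  rw [← inv_div, ← i4]
  generalize euclid α β = l at i1 i2 i3
  obtain ⟨l, a, rfl⟩ : ∃ l' a, l = l' ++ [a] := ⟨_, _, (List.dropLast_append_getLast i1).symm⟩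
  rw [List.dropLast_concat] at i3
  have frac : ∀ l : List ℕ, Proper l →
      0 < 1 / fraction (l.map fun a : ℕ => (a : ℤ)) ∧
        1 / fraction (l.map fun a : ℕ => (a : ℤ)) < 1 := by
    intro l hl
    have h := hl.one_lt_fraction
    exact ⟨by positivity, (div_lt_one (by linarith)).2 h⟩
  rcases Nat.eq_zero_or_pos a with rfl | ha
  -- If `aₘ = 0`, then `β / α = [aₘ₋₁, …, a₁]`, and the last `aₘ₋₁` crossings lie on the right.
  · have hl : l ≠ [] := by
      rintro rfl
      exact absurd (i2 0 rfl) (by norm_num)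
    rw [List.head?_append_of_ne_nil _ hl] at i2
    have hp : Proper l := ⟨hl, i2, i3⟩
    have e1 : (Tangle.ofNats s (l ++ [0])).reflect.cls = (Tangle.ofNats s l).cls := by
      rw [Tangle.ofNats_append s hl, Tangle.mul, Tangle.reflect, Tangle.reflect_reflect]
      exact stack_infty (Tangle.ofNats s l).cls
    have e2 : (fraction ((l ++ [0]).map fun a : ℕ => (a : ℤ)))⁻¹
        = fraction (l.map fun a : ℕ => (a : ℤ)) := by
      rw [List.map_append, List.map_singleton, fraction_append (by simpa using hl)]
      simp
    rw [e1, e2]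
    obtain ⟨l, b, rfl⟩ : ∃ l' a, l = l' ++ [a] := ⟨_, _, (List.dropLast_append_getLast hl).symm⟩
    by_cases hl' : l = []
    · subst hl'
      refine ⟨1, b, ?_, .inr ⟨rfl, by simp [fraction]⟩⟩
      rw [List.nil_append, Tangle.ofNats_singleton, Tangle.cls_copies, one_mul]
    · have hp' := (hp.of_append hl').1
      refine ⟨_, b, ?_, .inl ⟨(hp'.cls s).2, _, (frac l hp').1, (frac l hp').2, ?_⟩⟩
      · rw [Tangle.ofNats_append s hl', Tangle.mul, Tangle.cls_add, Tangle.cls_copies]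
      · rw [List.map_append, List.map_singleton, fraction_append (by simpa using hl')]
        simp
  -- If `aₘ ≥ 1`, then `β / α < 1`, and no crossings split off.
  · have hp : Proper (l ++ [a]) := by
      refine ⟨i1, i2, fun x hx => ?_⟩
      rcases List.mem_append.1 hx with hx | hx
      · exact i3 x hx
      · rw [List.mem_singleton.1 hx]
        exact ha
    refine ⟨_, 0, (mul_one _).symm, .inl ⟨(hp.cls s).2, _, (frac _ hp).1, (frac _ hp).2, ?_⟩⟩
    simp

/-- The tangle `t0` is a positive block and `⌊1 / t⌋` crossings. -/
theorem cls_rational_mul_zero (t : ℚ) (h0 : t ≠ 0) (h1 : t ≠ 1) (h2 : t ≠ -1) :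
    ∃ q : TangleClass 2 2, ((Tangle.rational t).mul .zero).cls = q * ↑(crossingUnit ^ ⌊1 / t⌋) ∧
      (IsRationalBlock true q ∨ (q = 1 ∧ Int.fract (1 / t) = 0)) := by
  have hα : t.num.natAbs ≠ 0 := by simpa using h0
  have hn : ¬ (t.num.natAbs = 1 ∧ t.den = 1) := by
    rintro ⟨h, h'⟩
    have e := Rat.num_div_den t
    rw [h', Nat.cast_one, div_one] at e
    rcases Int.natAbs_eq t.num with hs | hs <;> rw [h] at hs
    · exact h1 (by rw [← e, hs]; norm_num)
    · exact h2 (by rw [← e, hs]; norm_num)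
  have reduce : ((Tangle.rational t).mul .zero).cls = (Tangle.rational t).reflect.cls :=
    mul_one (Tangle.rational t).reflect.cls
  rw [reduce]
  have abs_eq : ((t.num.natAbs : ℕ) : ℚ) / t.den = |t| := by
    rw [Nat.cast_natAbs, Int.cast_abs, ← Nat.abs_cast t.den, ← abs_div, Rat.num_div_den]
  rcases lt_or_gt_of_ne h0 with ht | ht
  · have e : Tangle.rational t = Tangle.ofNats false (euclid t.num.natAbs t.den) := by
      rw [Tangle.rational, conwayInts, Int.sign_eq_neg_one_of_neg (Rat.num_neg.2 ht)]
      rfl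
    obtain ⟨q, f, hq, h⟩ := cls_reflect_ofNats_euclid false t.reduced hα t.den_nz hn
    rw [← inv_div, abs_eq, abs_of_neg ht] at h
    have e' : 1 / t = -(-t)⁻¹ := by rw [one_div, inv_neg, neg_neg]
    rw [e, hq, e']
    rcases h with ⟨hb, r, r0, r1, hr⟩ | ⟨rfl, hf⟩
    -- `-(f + r) = -(f + 1) + (1 - r)`: one of the negative crossings makes the block positive.
    · refine ⟨_, ?_, .inl hb.mul_oneCrossing⟩
      have hfl : ⌊-(-t)⁻¹⌋ = -((f + 1 : ℕ) : ℤ) := by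
        rw [hr, Int.floor_eq_iff]
        push_cast
        constructor <;> linarith
      rw [hfl, ← oneCrossing_false_pow, mul_assoc, pow_succ', ← mul_assoc (oneCrossing _)]
      have h := oneCrossing_mul_not true
      rw [Bool.not_true] at h
      rw [Bool.not_false, h, one_mul]
    · refine ⟨1, ?_, .inr ⟨rfl, ?_⟩⟩
      · rw [hf, oneCrossing_false_pow, Int.floor_neg, Int.ceil_natCast]
      · rw [hf, ← Int.cast_natCast, ← Int.cast_neg, Int.fract_intCast]
  · have e : Tangle.rational t = Tangle.ofNats true (euclid t.num.natAbs t.den) := by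
      rw [Tangle.rational, conwayInts, Int.sign_eq_one_of_pos (Rat.num_pos.2 ht)]
      rfl
    obtain ⟨q, f, hq, h⟩ := cls_reflect_ofNats_euclid true t.reduced hα t.den_nz hn
    rw [← inv_div, abs_eq, abs_of_pos ht] at h
    rw [e, hq, one_div]
    refine ⟨q, ?_, ?_⟩
    · have hfl : ⌊t⁻¹⌋ = (f : ℤ) := by
        rcases h with ⟨-, r, r0, r1, hr⟩ | ⟨-, hf⟩
        · rw [hr, Int.floor_eq_iff]
          push_cast
          constructor <;> linarith
        · rw [hf, Int.floor_natCast]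
      rw [hfl, oneCrossing_true_pow]
    · rcases h with ⟨hb, -⟩ | ⟨hq, hf⟩
      · exact .inl hb
      · exact .inr ⟨hq, by rw [hf, Int.fract_natCast]⟩

/-- The closure `1*w` of a tangle diagram with two ends on each side. -/
def closureDiagram (w : Word) (hw : IsTangle 2 w 2) : LinkDiagram where
  word := [⟨.birth, 0⟩, ⟨.birth, 2⟩] ++ shift 1 w ++ [⟨.death, 0⟩, ⟨.death, 0⟩]
  closed := by
    have h0 : IsTangle 0 [⟨.birth, 0⟩, ⟨.birth, 2⟩] 4 := isTangle_of_run rfl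
    exact (h0.append (hw.shift 1 1)).append (isTangle_of_run rfl)

theorem isotopic_closureDiagram {t : Tangle} {w : Word} (hw : IsTangle 2 w 2)
    (h : t.cls = mk w hw) : t.closure.Isotopic (closureDiagram w hw) := by
  have h0 : IsTangle 0 [⟨.birth, 0⟩, ⟨.birth, 2⟩] 4 := isTangle_of_run rfl
  have h1 : Isot 4 4 (shift 1 t.word) (shift 1 w) :=
    Isot.shift (n := 2) (m := 2) ⟨t.isTangle_word, hw, h⟩ 1 1
  exact Isot.isotopic ((h1.append_left h0).append_right (isTangle_of_run rfl))

theorem prod_ofFn_mul_zpow {M : Type*} [Monoid M] (u : Mˣ) {p : ℕ} (q : Fin p → M) (f : Fin p → ℤ)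
    (h : ∀ i, Commute (q i) u) :
    (List.ofFn fun i => q i * ↑(u ^ f i)).prod = ↑(u ^ ∑ i, f i) * (List.ofFn q).prod := by
  induction p with
  | zero => simp
  | succ p ih =>
    have hc : ∀ n : ℤ, q 0 * ↑(u ^ n) = ↑(u ^ n) * q 0 := fun n => (h 0).units_zpow_right n
    rw [List.ofFn_succ, List.ofFn_succ, List.prod_cons, List.prod_cons, ih _ _ fun i => h i.succ,
      Fin.sum_univ_succ, zpow_add, Units.val_mul, hc, mul_assoc, mul_assoc, ← mul_assoc (q 0), hc,
      mul_assoc]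

theorem Tangle.cls_foldl_add {α : Type*} (g : α → Tangle) (l : List α) (s : Tangle) :
    (l.foldl (fun s x => s.add (g x)) s).cls = s.cls * (l.map fun x => (g x).cls).prod := by
  induction l generalizing s with
  | nil => exact (mul_one _).symm
  | cons a l ih =>
    rw [List.foldl_cons, ih, cls_add, List.map_cons, List.prod_cons, mul_assoc]

/-- The crossings of a Montesinos link may be collected: what remains are `ε` crossings and
positive blocks. -/
theorem cls_montesinosTangle {p : ℕ} (e : ℤ) (t : Fin p → ℚ)
    (ht : ∀ i, t i ≠ 0 ∧ t i ≠ 1 ∧ t i ≠ -1) :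
    ∃ l : List (TangleClass 2 2), l.length = p ∧
      (∀ q ∈ l, IsRationalBlock true q ∨ (q = 1 ∧ ∃ i, Int.fract (1 / t i) = 0)) ∧
      (montesinosTangle e t).cls = ↑(crossingUnit ^ epsilon e t) * l.prod := by
  choose q hq hq' using fun i => cls_rational_mul_zero (t i) (ht i).1 (ht i).2.1 (ht i).2.2
  refine ⟨List.ofFn q, List.length_ofFn, fun x hx => ?_, ?_⟩
  · obtain ⟨i, rfl⟩ := List.mem_ofFn.1 hx
    exact (hq' i).imp_right fun h => ⟨h.1, i, h.2⟩
  · have hc : ∀ i, Commute (q i) (crossingUnit : TangleClass 2 2) := by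
      intro i
      rcases hq' i with h | ⟨h, -⟩
      · exact h.commute true
      · rw [h]
        exact Commute.one_left _
    rw [montesinosTangle, Tangle.cls_foldl_add, Tangle.cls_int, List.map_ofFn, epsilon, zpow_add,
      Units.val_mul, mul_assoc, ← prod_ofFn_mul_zpow _ _ _ hc]
    congr 3
    ext1 i
    exact hq i

/-! ### A criterion for alternating diagrams -/

/-- The arcs of a diagram, with the orientation in which the strands of even height run to the
right and the strands of odd height run to the left. -/
inductive Arrow (w : Word) : ℕ × ℕ → ℕ × ℕ → Prop
  | passEven (i : ℕ) (l : Layer) (j j' : ℕ) (hl : w[i]? = some l) (h : l.Passes j j')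
      (hj : j % 2 = 0) : Arrow w (i, j) (i + 1, j')
  | passOdd (i : ℕ) (l : Layer) (j j' : ℕ) (hl : w[i]? = some l) (h : l.Passes j j')
      (hj : j % 2 = 1) : Arrow w (i + 1, j') (i, j)
  | birthEven (i k : ℕ) (hl : w[i]? = some ⟨.birth, k⟩) (hk : k % 2 = 0) :
      Arrow w (i + 1, k + 1) (i + 1, k)
  | birthOdd (i k : ℕ) (hl : w[i]? = some ⟨.birth, k⟩) (hk : k % 2 = 1) :
      Arrow w (i + 1, k) (i + 1, k + 1)
  | deathEven (i k : ℕ) (hl : w[i]? = some ⟨.death, k⟩) (hk : k % 2 = 0) :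
      Arrow w (i, k) (i, k + 1)
  | deathOdd (i k : ℕ) (hl : w[i]? = some ⟨.death, k⟩) (hk : k % 2 = 1) :
      Arrow w (i, k + 1) (i, k)

theorem Arrow.of_arcAdj {w : Word} {x y : ℕ × ℕ} (h : ArcAdj w x y) :
    Arrow w x y ∨ Arrow w y x := by
  cases h with
  | pass i l j j' hl h =>
    rcases Nat.mod_two_eq_zero_or_one j with hj | hj
    · exact .inl (.passEven i l j j' hl h hj)
    · exact .inr (.passOdd i l j j' hl h hj)
  | birth i k hl =>
    rcases Nat.mod_two_eq_zero_or_one k with hj | hj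
    · exact .inr (.birthEven i k hl hj)
    · exact .inl (.birthOdd i k hl hj)
  | death i k hl =>
    rcases Nat.mod_two_eq_zero_or_one k with hj | hj
    · exact .inl (.deathEven i k hl hj)
    · exact .inr (.deathOdd i k hl hj)

theorem Layer.Passes.mod_two {l : Layer} {j j' : ℕ} (h : l.Passes j j') : j' % 2 = j % 2 := by
  obtain ⟨g, k⟩ := l
  rcases h with ⟨-, rfl⟩ | ⟨d, rfl, rfl⟩
  · rfl
  · cases g <;> simp only [Gen.ins, Gen.outs] <;> omega

/-- The oriented arcs do not branch. -/
theorem Arrow.leftUnique (w : Word) : Relator.LeftUnique (Arrow w) := by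
  intro x y z h1 h2
  cases h1 <;> cases h2 <;> grind [Layer.Passes, Gen.ins, Gen.outs, Layer.Passes.mod_two]

theorem Arrow.rightUnique (w : Word) : Relator.RightUnique (Arrow w) := by
  intro x y z h1 h2
  cases h1 <;> cases h2 <;> grind [Layer.Passes, Gen.ins, Gen.outs, Layer.Passes.mod_two]

/-- A path component of a relation without branchings has at most one starting point. -/
theorem eq_of_eqvGen_of_no_pred {α : Type*} {r : α → α → Prop} (hl : Relator.LeftUnique r)
    (hr : Relator.RightUnique r) {x y : α} (h : Relation.EqvGen r x y) (hx : ∀ z, ¬ r z x)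
    (hy : ∀ z, ¬ r z y) : x = y := by
  have key : Relation.ReflTransGen r x y ∨ Relation.ReflTransGen r y x := by
    clear hx hy
    induction h with
    | rel x y h => exact .inl (.single h)
    | refl x => exact .inl .refl
    | symm x y _ ih => exact ih.symm
    | trans x y z _ _ ih ih' =>
      rcases ih with h | h <;> rcases ih' with h' | h'
      · exact .inl (h.trans h')
      · rw [← Relation.reflTransGen_swap] at h h'
        have hr' : Relator.RightUnique (Function.swap r) := fun _ _ _ h h' => hl h h'
        have := Relation.ReflTransGen.total_of_right_unique hr' h h'
        rw [Relation.reflTransGen_swap] at this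
        exact this.symm.imp Relation.reflTransGen_swap.1 id
      · exact Relation.ReflTransGen.total_of_right_unique hr h h'
      · exact .inr (h'.trans h)
  rcases key with h | h
  · rcases Relation.ReflTransGen.cases_tail h with h | ⟨z, -, hz⟩
    exacts [h.symm, absurd hz (hy z)]
  · rcases Relation.ReflTransGen.cases_tail h with h | ⟨z, -, hz⟩
    exacts [h, absurd hz (hx z)]

theorem eq_of_eqvGen_of_no_succ {α : Type*} {r : α → α → Prop} (hl : Relator.LeftUnique r)
    (hr : Relator.RightUnique r) {x y : α} (h : Relation.EqvGen r x y) (hx : ∀ z, ¬ r x z)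
    (hy : ∀ z, ¬ r y z) : x = y := by
  have h' : Relation.EqvGen (Function.swap r) x y := by
    clear hx hy
    induction h with
    | rel x y h => exact (Relation.EqvGen.rel y x h).symm
    | refl x => exact .refl x
    | symm x y _ ih => exact ih.symm
    | trans x y z _ _ ih ih' => exact ih.trans _ _ _ ih'
  exact eq_of_eqvGen_of_no_pred (r := Function.swap r) (fun _ _ _ h h' => hr h h')
    (fun _ _ _ h h' => hl h h') h' hx hy

theorem Arrow.eqvGen {w : Word} {x y : ℕ × ℕ} (h : Relation.EqvGen (ArcAdj w) x y) :
    Relation.EqvGen (Arrow w) x y := by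
  induction h with
  | rel x y h =>
    rcases Arrow.of_arcAdj h with h | h
    exacts [.rel _ _ h, (Relation.EqvGen.rel _ _ h).symm]
  | refl x => exact .refl x
  | symm x y _ ih => exact ih.symm
  | trans x y z _ _ ih ih' => exact ih.trans _ _ _ ih'

/-- The arc at an end of a crossing of the strands `k` and `k + 1` is oriented away from the
crossing. -/
def Corner.IsSource (k : ℕ) : Corner → Prop
  | nw => k % 2 = 1
  | sw => k % 2 = 0
  | ne => k % 2 = 0
  | se => k % 2 = 1

theorem Corner.no_pred {w : Word} {i k : ℕ} {s : Bool} {c : Corner}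
    (hl : w[i]? = some ⟨.cross s, k⟩) (hc : c.IsSource k) (z : ℕ × ℕ) :
    ¬ Arrow w z (c.point i k) := by
  intro h
  generalize hp : c.point i k = p at h
  cases c <;> cases h <;>
    grind [Corner.point, Corner.IsSource, Layer.Passes, Gen.ins, Gen.outs, Layer.Passes.mod_two]

theorem Corner.no_succ {w : Word} {i k : ℕ} {s : Bool} {c : Corner}
    (hl : w[i]? = some ⟨.cross s, k⟩) (hc : ¬ c.IsSource k) (z : ℕ × ℕ) :
    ¬ Arrow w (c.point i k) z := by
  intro h
  generalize hp : c.point i k = p at h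
  cases c <;> cases h <;>
    grind [Corner.point, Corner.IsSource, Layer.Passes, Gen.ins, Gen.outs, Layer.Passes.mod_two]

/-- Every crossing has the sign that the parity of its height prescribes, up to a global choice
`c`: all crossings have the same type with respect to a checkerboard colouring of the regions. -/
def Checkered (c : Bool) (w : Word) : Prop :=
  ∀ (s : Bool) (k : ℕ), ⟨.cross s, k⟩ ∈ w → (s = c ↔ k % 2 = 0)

/-- In a checkered diagram every edge is oriented from an overcrossing to an undercrossing (or
every edge is oriented in the opposite way). -/
theorem LinkDiagram.alternating_of_checkered {D : LinkDiagram} {c : Bool}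
    (h : Checkered c D.word) : D.Alternating := by
  intro i k s a i' k' s' a' hl hl' hne hconn
  -- The global choice `c` decides whether edges begin or end at overcrossings.
  have isOver : ∀ {i k : ℕ} {s : Bool} {a : Corner}, D.word[i]? = some ⟨.cross s, k⟩ →
      (a.IsOver s ↔ (a.IsSource k ↔ c = true)) := by
    intro i k s a hl
    have hs := h s k (List.mem_of_getElem? hl)
    cases a <;> cases s <;> cases c <;> simp [Corner.IsOver, Corner.IsSource] at hs ⊢ <;> omega
  have conn := Arrow.eqvGen hconn
  -- Two starting points (or two end points) of edges that coincide belong to the same corner.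
  have corner : a.point i k = a'.point i' k' → ¬ (a.IsSource k ↔ a'.IsSource k') := by
    intro e hs
    apply hne
    cases a <;> cases a' <;> grind [Corner.point, Corner.IsSource]
  rw [isOver hl, isOver hl']
  by_cases ha : a.IsSource k <;> by_cases ha' : a'.IsSource k'
  · exact absurd (iff_of_true ha ha') (corner (eq_of_eqvGen_of_no_pred (Arrow.leftUnique _)
      (Arrow.rightUnique _) conn (Corner.no_pred hl ha) (Corner.no_pred hl' ha')))
  · simp [ha, ha']
  · simp [ha, ha']
  · exact absurd (iff_of_false ha ha') (corner (eq_of_eqvGen_of_no_succ (Arrow.leftUnique _)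
      (Arrow.rightUnique _) conn (Corner.no_succ hl ha) (Corner.no_succ hl' ha')))

theorem Checkered.append {c : Bool} {u v : Word} (hu : Checkered c u) (hv : Checkered c v) :
    Checkered c (u ++ v) := fun s k h => (List.mem_append.1 h).elim (hu s k) (hv s k)

theorem Checkered.shift_one {c : Bool} {w : Word} (hw : Checkered c w) :
    Checkered (!c) (shift 1 w) := by
  intro s k h
  obtain ⟨⟨g, j⟩, hm, hj⟩ := List.mem_map.1 h
  obtain ⟨rfl, rfl⟩ := Layer.mk.inj hj
  have h1 := hw s j hm
  cases s <;> cases c <;> simp at h1 ⊢ <;> omega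

theorem alternating_closureDiagram {c : Bool} {w : Word} (hw : IsTangle 2 w 2)
    (h : Checkered c w) : (closureDiagram w hw).Alternating := by
  refine LinkDiagram.alternating_of_checkered (c := !c) (Checkered.append (.append ?_ h.shift_one) ?_)
  · intro s k hk
    simp at hk
  · intro s k hk
    simp at hk

/-! ### Diagrams of rational blocks -/

/-- A crossing of sign `s` added on the right (`true`) or below (`false`). -/
def letter (s : Bool) : Bool → Layer
  | true => ⟨.cross s, 0⟩
  | false => ⟨.cross (!s), 1⟩

/-- The diagram of a rational block of sign `s`. -/
def blockWord (s : Bool) (l : List Bool) : Word :=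
  [⟨.birth, 0⟩, ⟨.birth, 1⟩, ⟨.cross s, 0⟩] ++ l.map (letter s) ++
    [⟨.cross (!s), 1⟩, ⟨.death, 3⟩, ⟨.death, 2⟩]

theorem AltTwists.exists_word {s : Bool} {x : TangleClass 0 4} (hx : AltTwists s x) :
    ∃ (l : List Bool) (h : _), x = mk ([⟨.birth, 0⟩, ⟨.birth, 1⟩, ⟨.cross s, 0⟩] ++ l.map (letter s)) h := by
  induction hx with
  | start => exact ⟨[], isTangle_of_run rfl, rfl⟩
  | addRight _ ih =>
    obtain ⟨l, h, rfl⟩ := ih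
    have e : ∀ u : Word, u ++ (l ++ [true]).map (letter s) =
        u ++ l.map (letter s) ++ [⟨.cross s, 0⟩] := by
      simp [letter]
    refine ⟨l ++ [true], ?_, ?_⟩
    · rw [e]
      exact h.append (isTangle_of_run rfl)
    · rw [twist_mk]
      simp [letter]
  | stackBelow _ ih =>
    obtain ⟨l, h, rfl⟩ := ih
    have e : ∀ u : Word, u ++ (l ++ [false]).map (letter s) =
        u ++ l.map (letter s) ++ [⟨.cross (!s), 1⟩] := by
      simp [letter]
    refine ⟨l ++ [false], ?_, ?_⟩
    · rw [e]
      exact h.append (isTangle_of_run rfl)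
    · rw [twist_mk]
      simp [letter]

theorem isTangle_letters (s : Bool) (l : List Bool) :
    IsTangle 0 ([⟨.birth, 0⟩, ⟨.birth, 1⟩, ⟨.cross s, 0⟩] ++ l.map (letter s)) 4 := by
  have h : IsTangle 4 (l.map (letter s)) 4 := by
    induction l with
    | nil => rfl
    | cons c l ih =>
      refine ⟨4, ?_, ih⟩
      cases c
      · exact ⟨1, rfl, rfl⟩
      · exact ⟨2, rfl, rfl⟩
  exact IsTangle.append (isTangle_of_run rfl) h

theorem isTangle_blockWord (s : Bool) (l : List Bool) : IsTangle 2 (blockWord s l) 2 := by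
  have h := ((isTangle_letters s l).append
    (isTangle_of_run rfl : IsTangle 4 [⟨.cross (!s), 1⟩] 4)).bend
  simpa [blockWord] using h

theorem IsRationalBlock.exists_word {s : Bool} {q : TangleClass 2 2} (h : IsRationalBlock s q) :
    ∃ l, q = mk (blockWord s l) (isTangle_blockWord s l) := by
  obtain ⟨x, hx, rfl⟩ := h
  obtain ⟨l, h, rfl⟩ := hx.exists_word
  refine ⟨l, ?_⟩
  rw [twist_mk, bend_mk]
  simp [blockWord]

theorem checkered_blockWord (s : Bool) (l : List Bool) : Checkered s (blockWord s l) := by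
  intro s' k h
  simp only [blockWord, List.mem_append, List.mem_cons, List.mem_map, Layer.mk.injEq,
    reduceCtorEq, List.not_mem_nil, Gen.cross.injEq, false_and, or_false, false_or] at h
  rcases h with (⟨rfl, rfl⟩ | ⟨c, -, h⟩) | ⟨rfl, rfl⟩
  · simp
  · cases c <;> simp only [letter, Layer.mk.injEq, Gen.cross.injEq] at h <;>
      obtain ⟨rfl, rfl⟩ := h <;> simp
  · simp

/-- A tangle that has a checkered diagram. -/
def IsCheckered (c : Bool) (q : TangleClass 2 2) : Prop :=
  ∃ w h, q = mk w h ∧ Checkered c w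

theorem IsCheckered.one (c : Bool) : IsCheckered c 1 :=
  ⟨[], rfl, rfl, fun _ _ h => absurd h List.not_mem_nil⟩

theorem IsCheckered.mul {c : Bool} {q r : TangleClass 2 2} (hq : IsCheckered c q)
    (hr : IsCheckered c r) : IsCheckered c (q * r) := by
  obtain ⟨u, hu, rfl, hu'⟩ := hq
  obtain ⟨v, hv, rfl, hv'⟩ := hr
  exact ⟨_, hu.append hv, rfl, hu'.append hv'⟩

theorem IsCheckered.oneCrossing_pow (s : Bool) (a : ℕ) : IsCheckered s (oneCrossing s ^ a) := by
  induction a with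
  | zero => exact .one s
  | succ a ih =>
    rw [pow_succ]
    refine ih.mul ⟨_, _, rfl, fun s' k h => ?_⟩
    simp only [List.mem_singleton, Layer.mk.injEq, Gen.cross.injEq] at h
    simp [h.1, h.2]

theorem IsRationalBlock.isCheckered {s : Bool} {q : TangleClass 2 2} (h : IsRationalBlock s q) :
    IsCheckered s q := by
  obtain ⟨l, rfl⟩ := h.exists_word
  exact ⟨_, _, rfl, checkered_blockWord s l⟩

theorem IsCheckered.list_prod {c : Bool} {l : List (TangleClass 2 2)}
    (h : ∀ q ∈ l, IsCheckered c q) : IsCheckered c l.prod := by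
  induction l with
  | nil => exact .one c
  | cons q l ih =>
    rw [List.prod_cons]
    exact (h q (by simp)).mul (ih fun r hr => h r (by simp [hr]))

theorem IsCheckered.exists_alternating {c : Bool} {t : Tangle} (h : IsCheckered c t.cls) :
    ∃ D : LinkDiagram, t.closure.Isotopic D ∧ D.Alternating := by
  obtain ⟨w, hw, e, hc⟩ := h
  exact ⟨_, isotopic_closureDiagram hw e, alternating_closureDiagram hw hc⟩

/-- Changing the sign of every positive block of a product costs at most one crossing for each
block. -/
theorem exists_negative_blocks {l : List (TangleClass 2 2)}
    (h : ∀ q ∈ l, IsRationalBlock true q ∨ q = 1) :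
    ∃ (q : TangleClass 2 2) (n : ℕ), n ≤ l.length ∧ IsCheckered false q ∧
      l.prod = oneCrossing true ^ n * q := by
  induction l with
  | nil => exact ⟨1, 0, le_rfl, .one _, (one_mul _).symm⟩
  | cons r l ih =>
    obtain ⟨q, n, hn, hq, e⟩ := ih fun r hr => h r (by simp [hr])
    rw [List.prod_cons, e]
    rcases h r (by simp) with hr | rfl
    · refine ⟨r * oneCrossing false * q, n + 1, by simpa using hn,
        hr.mul_oneCrossing.isCheckered.mul hq, ?_⟩
      have h1 := oneCrossing_mul_not true
      rw [Bool.not_true] at h1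
      have h2 : r = oneCrossing true * (r * oneCrossing false) := by
        rw [← mul_assoc, ← (hr.commute true).eq, mul_assoc, h1, mul_one]
      have h3 : Commute (r * oneCrossing false) (oneCrossing true ^ n) :=
        (hr.mul_oneCrossing.commute true).pow_right n
      rw [← mul_assoc, pow_succ', ← mul_assoc, mul_assoc (oneCrossing true), ← h3.eq, ← mul_assoc,
        ← h2]
    · exact ⟨q, n, by simp; omega, hq, by rw [one_mul]⟩

/-- The alternating diagram of a Montesinos link. -/
theorem exists_alternating {p : ℕ} (e : ℤ) (t : Fin p → ℚ)
    (ht : ∀ i, t i ≠ 0 ∧ t i ≠ 1 ∧ t i ≠ -1) (hε : 0 ≤ epsilon e t ∨ epsilon e t ≤ -p) :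
    ∃ D : LinkDiagram, (montesinosLink e t).Isotopic D ∧ D.Alternating := by
  obtain ⟨l, hl, hb, hcls⟩ := cls_montesinosTangle e t ht
  rcases hε with hε | hε
  · refine IsCheckered.exists_alternating (c := true) ?_
    obtain ⟨n, hn⟩ := Int.eq_ofNat_of_zero_le hε
    rw [hcls, hn, ← oneCrossing_true_pow]
    refine (IsCheckered.oneCrossing_pow true n).mul (.list_prod fun q hq => ?_)
    rcases hb q hq with h | ⟨rfl, -⟩
    exacts [h.isCheckered, .one _]
  · refine IsCheckered.exists_alternating (c := false) ?_
    obtain ⟨q, n, hn, hq, e'⟩ := exists_negative_blocks fun q hq => (hb q hq).imp_right And.left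
    obtain ⟨m, hm⟩ := Int.eq_ofNat_of_zero_le (a := -epsilon e t - n) (by omega)
    rw [hcls, e', oneCrossing_true_pow, ← mul_assoc, ← Units.val_mul, ← zpow_add,
      show epsilon e t + n = -(m : ℤ) by omega, ← oneCrossing_false_pow]
    exact (IsCheckered.oneCrossing_pow false m).mul hq

/-! ### A criterion for adequate diagrams -/

/-- The labels of the strands on both sides of a layer, if all crossings are smoothed in the way
`σ`: labels are constant along the arcs of the state, and the two arcs that replace a crossing have
different labels. -/
inductive LayerLabelled (σ : Bool) : List ℕ → Layer → List ℕ → Prop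
  | birth (x y : List ℕ) (a k : ℕ) (hk : k = x.length) :
      LayerLabelled σ (x ++ y) ⟨.birth, k⟩ (x ++ a :: a :: y)
  | death (x y : List ℕ) (a k : ℕ) (hk : k = x.length) :
      LayerLabelled σ (x ++ a :: a :: y) ⟨.death, k⟩ (x ++ y)
  | vertical (x y : List ℕ) (a b k : ℕ) (hab : a ≠ b) (hk : k = x.length) :
      LayerLabelled σ (x ++ a :: a :: y) ⟨.cross σ, k⟩ (x ++ b :: b :: y)
  | horizontal (x y : List ℕ) (a b k : ℕ) (hab : a ≠ b) (hk : k = x.length) :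
      LayerLabelled σ (x ++ a :: b :: y) ⟨.cross (!σ), k⟩ (x ++ a :: b :: y)

/-- The word `w` has a labelling of its smoothing `σ` with the given labels of its left and of its
right ends. -/
def Labelled (σ : Bool) : List ℕ → Word → List ℕ → Prop
  | x, [], y => x = y
  | x, l :: w, z => ∃ y, LayerLabelled σ x l y ∧ Labelled σ y w z

namespace Labelled

variable {σ : Bool} {x y z : List ℕ} {u v w : Word} {l : Layer}

theorem append (hu : Labelled σ x u y) (hv : Labelled σ y v z) : Labelled σ x (u ++ v) z := by
  induction u generalizing x with
  | nil =>
    cases hu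
    exact hv
  | cons l u ih =>
    obtain ⟨y', h, h'⟩ := hu
    exact ⟨y', h, ih h'⟩

theorem cons (hl : LayerLabelled σ x l y) (hw : Labelled σ y w z) : Labelled σ x (l :: w) z :=
  ⟨y, hl, hw⟩

theorem _root_.Montesinos.LayerLabelled.shift (h : LayerLabelled σ x l y) (a b : List ℕ) :
    LayerLabelled σ (a ++ x ++ b) ⟨l.gen, a.length + l.pos⟩ (a ++ y ++ b) := by
  cases h with
  | birth x y c k hk => simpa using LayerLabelled.birth (a ++ x) (y ++ b) c _ (by simp [hk])
  | death x y c k hk => simpa using LayerLabelled.death (a ++ x) (y ++ b) c _ (by simp [hk])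
  | vertical x y c d k hcd hk =>
    simpa using LayerLabelled.vertical (a ++ x) (y ++ b) c d _ hcd (by simp [hk])
  | horizontal x y c d k hcd hk =>
    simpa using LayerLabelled.horizontal (a ++ x) (y ++ b) c d _ hcd (by simp [hk])

theorem shift (h : Labelled σ x w y) (a b : List ℕ) :
    Labelled σ (a ++ x ++ b) (Montesinos.shift a.length w) (a ++ y ++ b) := by
  induction w generalizing x with
  | nil =>
    cases h
    rfl
  | cons l w ih =>
    obtain ⟨x', h, h'⟩ := h
    exact ⟨_, h.shift a b, ih h'⟩

theorem exists_labels (h : Labelled σ x w y) :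
    ∃ L : ℕ → List ℕ, L 0 = x ∧ ∀ i l, w[i]? = some l → LayerLabelled σ (L i) l (L (i + 1)) := by
  induction w generalizing x with
  | nil => exact ⟨fun _ => x, rfl, fun i l h => by simp at h⟩
  | cons l w ih =>
    obtain ⟨x', h, h'⟩ := h
    obtain ⟨L, h0, hL⟩ := ih h'
    refine ⟨fun i => Nat.casesOn i x L, rfl, fun i l' hi => ?_⟩
    cases i with
    | zero =>
      simp only [List.getElem?_cons_zero, Option.some.injEq] at hi
      simpa [← hi, h0] using h
    | succ i => exact hL i l' (by simpa using hi)

end Labelled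

/-- The label of a strand is constant along the arcs of the state, so that a labelling separates
the two arcs at each crossing. -/
theorem LinkDiagram.adequate_of_labelled {D : LinkDiagram}
    (h : ∀ σ, ∃ x y, Labelled σ x D.word y) : D.Adequate := by
  intro σ i k s hl hconn
  obtain ⟨x, y, h⟩ := h σ
  obtain ⟨L, -, hL⟩ := h.exists_labels
  have const : ∀ p q : ℕ × ℕ, Relation.EqvGen (StateAdj D.word σ) p q →
      (L p.1)[p.2]? = (L q.1)[q.2]? := by
    intro p q hpq
    induction hpq with
    | rel p q hpq =>
      cases hpq with
      | arc _ _ h =>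
        cases h with
        | pass i l j j' hl h =>
          have hi := hL _ _ hl
          revert hi
          generalize L i = x, L (i + 1) = y
          intro hi
          cases hi <;> grind [Layer.Passes, Gen.ins, Gen.outs]
        | birth i k hl =>
          have hi := hL _ _ hl
          revert hi
          generalize L i = x, L (i + 1) = y
          intro hi
          cases hi with | birth x y a k hk => simp [hk]
        | death i k hl =>
          have hi := hL _ _ hl
          revert hi
          generalize L i = x, L (i + 1) = y
          intro hi
          cases hi with | death x y a k hk => simp [hk]
      | left i k hl | right i k hl | top i k hl | bottom i k hl =>
        have hi := hL _ _ hl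
        revert hi
        generalize L i = x, L (i + 1) = y
        intro hi
        generalize hg : Gen.cross _ = g at hi
        cases hi <;> simp_all
    | refl => rfl
    | symm _ _ _ ih => exact ih.symm
    | trans _ _ _ _ _ ih ih' => exact ih.trans ih'
  have e := const _ _ hconn
  have hi := hL _ _ hl
  simp only at e
  revert hi e
  generalize L i = x, L (i + 1) = y
  intro e hi
  -- The labels at the NW end and at the SE end are the two different labels `a` and `b`.
  cases hi <;> simp_all

/-! ### Adequacy of sums of positive and negative blocks -/

/-- In the smoothing that cuts the strands at the crossings added on the right, the state circles of
a sequence of twists can be labelled such that the outermost one on the right has the label `b`.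
The circles in between have labels different from the label `a` of the left side, which the
crossings added below require. -/
theorem exists_labelled_letters_vertical (s : Bool) {a b : ℕ} (hab : a ≠ b) (l : List Bool) :
    ∃ c, a ≠ c ∧ Labelled s [c, c, a, a, a, a] (l.map (letter s)) [b, b, a, a, a, a] := by
  induction l with
  | nil => exact ⟨b, hab, rfl⟩
  | cons d l ih =>
    obtain ⟨c, hc, h⟩ := ih
    cases d with
    | true =>
      obtain ⟨c', hc'⟩ := Infinite.exists_notMem_finset {a, c}
      simp only [Finset.mem_insert, Finset.mem_singleton, not_or] at hc'
      exact ⟨c', Ne.symm hc'.1, .cons (.vertical [] [a, a, a, a] c' c 0 hc'.2 rfl) h⟩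
    | false =>
      exact ⟨c, hc, .cons (.horizontal [c] [a, a, a] c a 1 hc.symm rfl) h⟩

/-- In this smoothing, the two left ends of a block are joined, and so are the two right ends. -/
theorem labelled_blockWord_vertical (s : Bool) {a b : ℕ} (hab : a ≠ b) (l : List Bool) :
    Labelled s [a, a] (blockWord s l) [b, b] := by
  obtain ⟨c, hc, h⟩ := exists_labelled_letters_vertical s hab l
  have h0 : Labelled s [a, a] [⟨.birth, 0⟩, ⟨.birth, 1⟩, ⟨.cross s, 0⟩] [c, c, a, a, a, a] :=
    .cons (.birth [] [a, a] a 0 rfl) (.cons (.birth [a] [a, a, a] a 1 rfl)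
      (.cons (.vertical [] [a, a, a, a] a c 0 hc rfl) rfl))
  have h1 : Labelled s [b, b, a, a, a, a] [⟨.cross (!s), 1⟩, ⟨.death, 3⟩, ⟨.death, 2⟩] [b, b] :=
    .cons (.horizontal [b] [a, a, a] b a 1 hab.symm rfl) (.cons (.death [b, b, a] [a] a 3 rfl)
      (.cons (.death [b, b] [] a 2 rfl) rfl))
  exact (h0.append h).append h1

/-- In the other smoothing, the crossings added below are cut, and all circles but the last one have
labels different from the label `a` of the upper side. -/
theorem exists_labelled_letters_horizontal (s : Bool) {a b c : ℕ} (hab : a ≠ b) (l : List Bool) :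
    ∃ d, a ≠ d ∧ Labelled (!s) [a, d, d, a, a, c] (l.map (letter s)) [a, b, b, a, a, c] := by
  induction l with
  | nil => exact ⟨b, hab, rfl⟩
  | cons e l ih =>
    obtain ⟨d, hd, h⟩ := ih
    cases e with
    | true =>
      have h0 := LayerLabelled.horizontal (σ := !s) [] [d, a, a, c] a d 0 hd rfl
      rw [Bool.not_not] at h0
      exact ⟨d, hd, .cons h0 h⟩
    | false =>
      obtain ⟨d', hd'⟩ := Infinite.exists_notMem_finset {a, d}
      simp only [Finset.mem_insert, Finset.mem_singleton, not_or] at hd'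
      exact ⟨d', Ne.symm hd'.1, .cons (.vertical [a] [a, a, c] d' d 1 hd'.2 rfl) h⟩

/-- In this smoothing, the upper ends of a block are joined, and so are the lower ends.  Both arcs may
lie on the same state circle, since the last crossing of the block is one added below. -/
theorem labelled_blockWord_horizontal (s : Bool) (a : ℕ) (l : List Bool) :
    Labelled (!s) [a, a] (blockWord s l) [a, a] := by
  obtain ⟨d, hd, h⟩ := exists_labelled_letters_horizontal s (c := a) a.lt_succ_self.ne l
  have h2 := LayerLabelled.horizontal (σ := !s) [] [d, a, a, a] a d 0 hd rfl
  rw [Bool.not_not] at h2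
  have h0 : Labelled (!s) [a, a] [⟨.birth, 0⟩, ⟨.birth, 1⟩, ⟨.cross s, 0⟩] [a, d, d, a, a, a] :=
    .cons (.birth [] [a, a] a 0 rfl) (.cons (.birth [a] [a, a, a] d 1 rfl) (.cons h2 rfl))
  have h1 : Labelled (!s) [a, a + 1, a + 1, a, a, a]
      [⟨.cross (!s), 1⟩, ⟨.death, 3⟩, ⟨.death, 2⟩] [a, a] :=
    .cons (.vertical [a] [a, a, a] (a + 1) a 1 a.lt_succ_self.ne' rfl)
      (.cons (.death [a, a, a] [a] a 3 rfl) (.cons (.death [a, a] [] a 2 rfl) rfl))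
  exact (h0.append h).append h1

/-- The sum of several blocks of sign `s`. -/
def blocksWord (s : Bool) (ls : List (List Bool)) : Word := ls.flatMap (blockWord s)

theorem isTangle_blocksWord (s : Bool) (ls : List (List Bool)) :
    IsTangle 2 (blocksWord s ls) 2 := by
  induction ls with
  | nil => rfl
  | cons l ls ih => exact (isTangle_blockWord s l).append ih

theorem labelled_blocksWord_horizontal (s : Bool) (a : ℕ) (ls : List (List Bool)) :
    Labelled (!s) [a, a] (blocksWord s ls) [a, a] := by
  induction ls with
  | nil => rfl
  | cons l ls ih => exact (labelled_blockWord_horizontal s a l).append ih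

theorem labelled_blocksWord_of_ne (s : Bool) {a b : ℕ} (hab : a ≠ b) {ls : List (List Bool)}
    (hls : ls ≠ []) : Labelled s [a, a] (blocksWord s ls) [b, b] := by
  induction ls generalizing a with
  | nil => exact absurd rfl hls
  | cons l ls ih =>
    by_cases h : ls = []
    · subst h
      simpa [blocksWord] using labelled_blockWord_vertical s hab l
    · obtain ⟨c, hc⟩ := Infinite.exists_notMem_finset {a, b}
      simp only [Finset.mem_insert, Finset.mem_singleton, not_or] at hc
      exact (labelled_blockWord_vertical s (Ne.symm hc.1) l).append (ih hc.2 h)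

/-- Between two blocks there is a state circle of its own, so that at least two blocks are needed
for the two sides of a block to lie on different circles of the closure. -/
theorem labelled_blocksWord_vertical (s : Bool) (a : ℕ) {ls : List (List Bool)}
    (hls : 2 ≤ ls.length) : Labelled s [a, a] (blocksWord s ls) [a, a] := by
  match ls, hls with
  | l :: l' :: ls, _ =>
    have h : Labelled s [a + 1, a + 1] (blocksWord s (l' :: ls)) [a, a] :=
      labelled_blocksWord_of_ne s a.lt_succ_self.ne' (by simp)
    exact (labelled_blockWord_vertical s a.lt_succ_self.ne l).append h

theorem Labelled.adequate_closureDiagram {w : Word} (hw : IsTangle 2 w 2)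
    (h : ∀ σ, Labelled σ [0, 0] w [0, 0]) : (closureDiagram w hw).Adequate := by
  refine LinkDiagram.adequate_of_labelled fun σ => ⟨[], [], ?_⟩
  have h0 : Labelled σ [] [⟨.birth, 0⟩, ⟨.birth, 2⟩] [0, 0, 0, 0] :=
    .cons (.birth [] [] 0 0 rfl) (.cons (.birth [0, 0] [] 0 2 rfl) rfl)
  have h1 : Labelled σ [0, 0, 0, 0] [⟨.death, 0⟩, ⟨.death, 0⟩] [] :=
    .cons (.death [] [0, 0] 0 0 rfl) (.cons (.death [] [] 0 0 rfl) rfl)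
  exact (h0.append ((h σ).shift [0] [0])).append h1

/-! ### Edges that do not alternate -/

/-- A strand below a diagram has no crossings. -/
theorem eqvGen_arcAdj_below {n m : ℕ} {u : Word} (hu : IsTangle n u m) (x y : Word) (j : ℕ) :
    Relation.EqvGen (ArcAdj (x ++ u ++ y)) (x.length, n + j) (x.length + u.length, m + j) := by
  induction u generalizing n x with
  | nil =>
    cases hu
    exact .refl _
  | cons l u ih =>
    obtain ⟨k, ⟨d, h1, h2⟩, hu⟩ := hu
    have h := ih hu (x ++ [l])
    simp only [List.append_assoc, List.cons_append, List.nil_append, List.length_append,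
      List.length_cons, List.length_nil, zero_add] at h ⊢
    refine Relation.EqvGen.trans _ (x.length + 1, k + j) _ (.rel _ _ (.pass _ l _ _ ?_ ?_)) ?_
    · simp
    · exact .inr ⟨d + j, by omega, by omega⟩
    · rwa [add_comm u.length 1, ← add_assoc]

/-- The lower right ends of a negative block and of the positive block that follows it are joined
by an edge that begins and ends with an overcrossing. -/
theorem not_alternating {D : LinkDiagram} {x u y : Word} (hu : IsTangle 1 u 5)
    (h : D.word = x ++ [⟨.cross true, 2⟩, ⟨.death, 4⟩, ⟨.death, 3⟩] ++ u ++
      [⟨.cross false, 2⟩, ⟨.death, 4⟩, ⟨.death, 3⟩] ++ y) : ¬ D.Alternating := by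
  intro halt
  obtain ⟨i, hi⟩ : ∃ i, i = x.length := ⟨_, rfl⟩
  obtain ⟨k, hk⟩ : ∃ k, k = x.length + 3 + u.length := ⟨_, rfl⟩
  have at_pos : ∀ (a b : Word) (l : Layer) (n : ℕ), D.word = a ++ l :: b → n = a.length →
      D.word[n]? = some l := by
    intro a b l n e hn
    rw [e, hn]
    simp
  have i0 : D.word[i]? = some ⟨.cross true, 2⟩ :=
    at_pos x _ _ _ (by rw [h]; simp only [List.append_assoc, List.cons_append]; rfl) hi
  have i1 : D.word[i + 1]? = some ⟨.death, 4⟩ :=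
    at_pos (x ++ [⟨.cross true, 2⟩]) _ _ _
      (by rw [h]; simp only [List.append_assoc, List.cons_append, List.nil_append]; rfl) (by simp [hi])
  have i2 : D.word[i + 2]? = some ⟨.death, 3⟩ :=
    at_pos (x ++ [⟨.cross true, 2⟩, ⟨.death, 4⟩]) _ _ _
      (by rw [h]; simp only [List.append_assoc, List.cons_append, List.nil_append]; rfl) (by simp [hi])
  have k0 : D.word[k]? = some ⟨.cross false, 2⟩ :=
    at_pos (x ++ [⟨.cross true, 2⟩, ⟨.death, 4⟩, ⟨.death, 3⟩] ++ u) _ _ _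
      (by rw [h]; simp only [List.append_assoc, List.cons_append, List.nil_append]; rfl)
      (by simp [hk]; omega)
  have k1 : D.word[k + 1]? = some ⟨.death, 4⟩ :=
    at_pos (x ++ [⟨.cross true, 2⟩, ⟨.death, 4⟩, ⟨.death, 3⟩] ++ u ++ [⟨.cross false, 2⟩]) _ _ _
      (by rw [h]; simp only [List.append_assoc, List.cons_append, List.nil_append]; rfl)
      (by simp [hk]; omega)
  have k2 : D.word[k + 2]? = some ⟨.death, 3⟩ :=
    at_pos (x ++ [⟨.cross true, 2⟩, ⟨.death, 4⟩, ⟨.death, 3⟩] ++ u ++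
        [⟨.cross false, 2⟩, ⟨.death, 4⟩]) _ _ _
      (by rw [h]; simp only [List.append_assoc, List.cons_append, List.nil_append]; rfl)
      (by simp [hk]; omega)
  have e1 : ArcAdj D.word (i + 1, 2) (i + 2, 2) := .pass _ _ _ _ i1 (.inl ⟨by norm_num, rfl⟩)
  have e2 : ArcAdj D.word (i + 2, 2) (i + 3, 2) := .pass _ _ _ _ i2 (.inl ⟨by norm_num, rfl⟩)
  have e3 : Relation.EqvGen (ArcAdj D.word) (i + 3, 2) (k, 6) := by
    have e := eqvGen_arcAdj_below hu (x ++ [⟨.cross true, 2⟩, ⟨.death, 4⟩, ⟨.death, 3⟩])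
      ([⟨.cross false, 2⟩, ⟨.death, 4⟩, ⟨.death, 3⟩] ++ y) 1
    rw [← List.append_assoc, ← h] at e
    rw [hi, hk]
    simpa using e
  have e4 : ArcAdj D.word (k, 6) (k + 1, 6) := .pass _ _ _ _ k0 (.inr ⟨2, rfl, rfl⟩)
  have e5 : ArcAdj D.word (k + 1, 6) (k + 2, 4) := .pass _ _ _ _ k1 (.inr ⟨0, rfl, rfl⟩)
  have e6 : ArcAdj D.word (k + 2, 3) (k + 2, 4) := .death _ _ k2
  have e7 : ArcAdj D.word (k + 1, 3) (k + 2, 3) := .pass _ _ _ _ k1 (.inl ⟨by norm_num, rfl⟩)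
  have conn : Relation.EqvGen (ArcAdj D.word) (Corner.point i 2 .ne) (Corner.point k 2 .se) :=
    (((((Relation.EqvGen.rel _ _ e1).trans _ _ _ (.rel _ _ e2)).trans _ _ _ e3).trans _ _ _
      (.rel _ _ e4)).trans _ _ _ (.rel _ _ e5)).trans _ _ _
        ((Relation.EqvGen.rel _ _ e6).symm.trans _ _ _ (Relation.EqvGen.rel _ _ e7).symm)
  have hc := halt i 2 true .ne k 2 false .se i0 k0 (by simp) conn
  simp [Corner.IsOver] at hc

theorem exists_blocksWord {s : Bool} {l : List (TangleClass 2 2)}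
    (h : ∀ q ∈ l, IsRationalBlock s q) :
    ∃ ls : List (List Bool), ls.length = l.length ∧
      l.prod = mk (blocksWord s ls) (isTangle_blocksWord s ls) := by
  induction l with
  | nil => exact ⟨[], rfl, rfl⟩
  | cons q l ih =>
    obtain ⟨ls, hls, e⟩ := ih fun r hr => h r (by simp [hr])
    obtain ⟨m, rfl⟩ := (h q (by simp)).exists_word
    exact ⟨m :: ls, by simp [hls], by rw [List.prod_cons, e]; rfl⟩

/-- The negative crossings of a Montesinos link may be distributed over as many positive blocks,
which thereby become negative. -/
theorem exists_prod_eq {l : List (TangleClass 2 2)} (h : ∀ q ∈ l, IsRationalBlock true q) :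
    ∃ l' : List (TangleClass 2 2), l'.length = l.length ∧ (∀ q ∈ l', IsRationalBlock false q) ∧
      oneCrossing false ^ l.length * l.prod = l'.prod := by
  induction l with
  | nil => exact ⟨[], rfl, by simp, one_mul _⟩
  | cons q l ih =>
    obtain ⟨l', hl, hb, e⟩ := ih fun r hr => h r (by simp [hr])
    have hq := h q (by simp)
    refine ⟨q * oneCrossing false :: l', by simp [hl], ?_, ?_⟩
    · intro r hr
      rcases List.mem_cons.1 hr with rfl | hr
      exacts [hq.mul_oneCrossing, hb r hr]
    · have hc := (hq.commute false).pow_right l.length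
      have hc' := hq.commute false
      rw [List.prod_cons, List.prod_cons, List.length_cons, ← e, pow_succ', ← mul_assoc,
        mul_assoc (oneCrossing false), ← hc.eq, ← mul_assoc, ← hc'.eq, mul_assoc, mul_assoc]

/-- The adequate diagram of a Montesinos link. -/
theorem exists_adequate {p : ℕ} (e : ℤ) (t : Fin p → ℚ)
    (ht : ∀ i, t i ≠ 0 ∧ t i ≠ 1 ∧ t i ≠ -1) (hf : ∀ i, Int.fract (1 / t i) ≠ 0)
    (h1 : epsilon e t ≤ -2) (h2 : 2 - (p : ℤ) ≤ epsilon e t) :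
    ∃ D : LinkDiagram, (montesinosLink e t).Isotopic D ∧ ¬ D.Alternating ∧ D.Adequate := by
  obtain ⟨l, hl, hb, hcls⟩ := cls_montesinosTangle e t ht
  replace hb : ∀ q ∈ l, IsRationalBlock true q := fun q hq =>
    (hb q hq).resolve_right fun ⟨_, i, hi⟩ => hf i hi
  obtain ⟨k, hk⟩ : ∃ k : ℕ, epsilon e t = -(k : ℤ) := ⟨(-epsilon e t).toNat, by omega⟩
  have hlen : (l.take k).length = k := by simp; omega
  obtain ⟨l', hl', hb', e'⟩ := exists_prod_eq (l := l.take k) fun q hq => hb q (List.mem_of_mem_take hq)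
  obtain ⟨a, ha, ea⟩ := exists_blocksWord hb'
  obtain ⟨b, hbl, eb⟩ := exists_blocksWord (l := l.drop k) fun q hq => hb q (List.mem_of_mem_drop hq)
  have ha2 : 2 ≤ a.length := by omega
  have hb2 : 2 ≤ b.length := by rw [hbl, List.length_drop]; omega
  have hw := (isTangle_blocksWord false a).append (isTangle_blocksWord true b)
  have hcls' : (montesinosTangle e t).cls = mk (blocksWord false a ++ blocksWord true b) hw := by
    rw [hcls, hk, ← oneCrossing_false_pow, ← List.prod_take_mul_prod_drop l k, ← mul_assoc]
    rw [hlen] at e'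
    rw [e', ea, eb]
    rfl
  refine ⟨_, isotopic_closureDiagram hw hcls', ?_, Labelled.adequate_closureDiagram hw ?_⟩
  -- The edge that does not alternate joins the last negative and the first positive block.
  · obtain ⟨a', m, rfl⟩ : ∃ a' m, a = a' ++ [m] :=
      ⟨_, _, (List.dropLast_append_getLast (List.ne_nil_of_length_pos (by omega))).symm⟩
    obtain ⟨m', b', rfl⟩ := List.exists_cons_of_length_pos (l := b) (by omega)
    have hu : IsTangle 1 (shift 1 ([⟨.birth, 0⟩, ⟨.birth, 1⟩, ⟨.cross true, 0⟩] ++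
        m'.map (letter true))) 5 :=
      (isTangle_letters true m').shift 1 0
    refine not_alternating (x := [⟨.birth, 0⟩, ⟨.birth, 2⟩] ++ shift 1 (blocksWord false a' ++
      ([⟨.birth, 0⟩, ⟨.birth, 1⟩, ⟨.cross false, 0⟩] ++ m.map (letter false)))) (y :=
      shift 1 (blocksWord true b') ++ [⟨.death, 0⟩, ⟨.death, 0⟩]) hu ?_
    simp [closureDiagram, blocksWord, blockWord, shift]
  · intro σ
    cases σ
    · exact (labelled_blocksWord_vertical false 0 ha2).append (labelled_blocksWord_horizontal true 0 b)
    · exact (labelled_blocksWord_horizontal false 0 a).append (labelled_blocksWord_vertical true 0 hb2)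

end Montesinos

open Montesinos in
theorem proposition3p4 (p : ℕ) (e : ℤ) (t : Fin p → ℚ)
    (ht : ∀ i, t i ≠ 0 ∧ t i ≠ 1 ∧ t i ≠ -1) :
    (|(epsilon e t : ℚ) + (p : ℚ) / 2| > (p : ℚ) / 2 - 1 →
      ∃ D : LinkDiagram, (montesinosLink e t).Isotopic D ∧ D.Alternating) ∧
    ((∀ i, Int.fract (1 / t i) ≠ 0) →
      |(epsilon e t : ℚ) + (p : ℚ) / 2| < (p : ℚ) / 2 - 1 →
      ∃ D : LinkDiagram, (montesinosLink e t).Isotopic D ∧ ¬ D.Alternating ∧ D.Adequate) := by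
  constructor
  · intro h
    refine exists_alternating e t ht ?_
    rcases lt_abs.1 h with h | h
    · left
      have h' : ((-1 : ℤ) : ℚ) < (epsilon e t : ℚ) := by
        push_cast
        linarith
      have := Int.cast_lt.1 h'
      omega
    · right
      have h' : (epsilon e t : ℚ) < ((-(p : ℤ) + 1 : ℤ) : ℚ) := by
        push_cast
        linarith
      have := Int.cast_lt.1 h'
      omega
  · intro hf h
    obtain ⟨h1, h2⟩ := abs_lt.1 h
    have h1' : ((1 - (p : ℤ) : ℤ) : ℚ) < (epsilon e t : ℚ) := by
      push_cast
      linarith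
    have h2' : (epsilon e t : ℚ) < ((-1 : ℤ) : ℚ) := by
      push_cast
      linarith
    have h1'' := Int.cast_lt.1 h1'
    have h2'' := Int.cast_lt.1 h2'
    exact exists_adequate e t ht hf (by omega) (by omega)
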